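/- Let $\mathcal A,\mathcal B$ be finite non-empty sets with $N_{\mathcal A},N_{\mathcal B}$ elements, let $\Delta(\cdot)$ denote the set of probability distributions on a finite set, and let $\overline m$ map each $(a,b)\in\mathcal A\times\mathcal B$ to a subset of $\mathbb R^d$. Assume that $\overline m$ is bounded by $M>0$: $\|s\|_2\le M$ for all $s\in\overline m(a,b)$ and all $(a,b)$. For $\mu\in\Delta(\mathcal A\times\mathcal B)$ put $\overline m(\mu)=\sum_{a,b}\mu_{a,b}\,\overline m(a,b)$ (Minkowski sums), and $\overline m(\mathbf x,\mathbf y)=\overline m(\mathbf x\otimes\mathbf y)$ for $\mathbf x\in\Delta(\mathcal A)$, $\mathbf y\in\Delta(\mathcal B)$. For sets $S,S'$ of vectors put $e(S,S')=\sup_{s\in S}\inf_{c\in S'}\|c-s\|_2\in[0,\infty]$, and $e(\mu,S')=e(\{\mu\},S')$, with $\inf\emptyset=\infty$ and $\sup\emptyset=0$. Two players play a repeated game with full monitoring, in one of two settings. *Pure actions:* at each round $t$ they draw $A_t\in\mathcal A$ and $B_t\in\mathcal B$, independently of each other given the past, by (randomized) strategies that depend on the past pairs of pure actions; $\pi_T=\frac1T\sum_{t=1}^T\delta_{(A_t,B_t)}$.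 *Mixed actions:* at each round $t$ they choose $\mathbf x_t\in\Delta(\mathcal A)$ and $\mathbf y_t\in\Delta(\mathcal B)$, independently of each other given the past, by (possibly randomized) strategies that depend on the past pairs of mixed actions; $\nu_T=\frac1T\sum_{t=1}^T\mathbf x_t\otimes\mathbf y_t$. Write $\rho_T$ for $\pi_T$ or $\nu_T$ according to the setting. A strategy of the first player *$\overline m$-robust approaches* $\mathcal C\subseteq\mathbb R^d$ if for all $\varepsilon>0$ there is $T_\varepsilon$ such that, for all strategies of the second player, $\mathbb P\{\forall T\ge T_\varepsilon:\ e(\overline m(\rho_T),\mathcal C)\le\varepsilon\}\ge1-\varepsilon$; $\mathcal C$ is *$\overline m$-robust approachable* (with pure, resp. mixed, actions) if some strategy does so. A strategy *approaches* a set $\mathcal D$ of vectors of $\mathbb R^{\mathcal A\times\mathcal B}$ (for the vector payoff $m(a,b)=\delta_{(a,b)}$, extended bilinearly) if the same holds with $e(\rho_T,\mathcal D)$ instead; $\mathcal D$ is *approachable* if some strategy does so. **Theorem.** Let $\mathcal C\subseteq\mathbb R^d$ be closed and convex, and consider the condition $$\text{(RAC)}\qquad \forall\,\mathbf y\in\Delta(\mathcal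 B)\ \ \exists\,\mathbf x\in\Delta(\mathcal A):\quad \overline m(\mathbf x,\mathbf y)\subseteq\mathcal C .$$ 1. $\mathcal C$ is $\overline m$-robust approachable with pure actions if and only if (RAC) holds, and $\mathcal C$ is $\overline m$-robust approachable with mixed actions if and only if (RAC) holds. 2. The set $\widetilde{\mathcal C}=\{\mu\in\Delta(\mathcal A\times\mathcal B):\overline m(\mu)\subseteq\mathcal C\}$ is closed and convex, and in each of the two settings it is approachable if and only if (RAC) holds. 3. For all $\mu\in\Delta(\mathcal A\times\mathcal B)$, $e(\overline m(\mu),\mathcal C)\le M\sqrt{N_{\mathcal A}N_{\mathcal B}}\;e(\mu,\widetilde{\mathcal C})$. In each setting, every strategy that approaches $\widetilde{\mathcal C}$ also $\overline m$-robust approaches $\mathcal C$. 4. Assume (RAC). - With mixed actions there is a deterministic strategy of the first player such that, for all strategies of the second player, with probability $1$, for all $T\ge1$: $e(\nu_T,\widetilde{\mathcal C})\le 2/\sqrt T$ and $e(\overline m(\nu_T),\mathcal C)\le 2M\sqrt{N_{\mathcal A}N_{\mathcal B}/T}$. - With pure actions there is a strategy of the first player such that, for all strategies of the second player, all $\delta\in(0,1)$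 and all $T\ge1$, with probability at least $1-\delta$, for all $S\ge T$: $e(\pi_S,\widetilde{\mathcal C})\le\beta$ and $e(\overline m(\pi_S),\mathcal C)\le M\sqrt{N_{\mathcal A}N_{\mathcal B}}\,\beta$, where $\beta=2\sqrt{2/(\delta T)}$. - With pure actions there is a strategy of the first player such that, for all strategies of the second player, all $\delta\in(0,1)$ and all $T\ge1$, with probability at least $1-\delta$: $e(\pi_T,\widetilde{\mathcal C})\le\beta'$ and $e(\overline m(\pi_T),\mathcal C)\le M\sqrt{N_{\mathcal A}N_{\mathcal B}}\,\beta'$, where $\beta'=\frac{2}{\sqrt T}\bigl(1+2\sqrt{\ln(2/\delta)}\bigr)$. -/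

import Mathlib

open MeasureTheory ProbabilityTheory

namespace RobustApproachability

noncomputable section

/-! ### Repeated two-player games with full monitoring

`X` is the set of actions of the first player at each round and `Y` that of the second player:
`X = A`, `Y = B` when pure actions are taken and observed, and `X = Δ(A)`, `Y = Δ(B)` when mixed
actions are taken and observed. Rounds are numbered from `0`. -/

/-- A (possibly randomized) strategy of a player whose actions lie in `U`, when `Z` is the set of
pairs of actions of one round: a law for the first action and, for every `n`, a Markov kernel that
gives the law of the action of round `n + 1` as a function of all the pairs of actions of the rounds
`0, …, n`. -/
structure Strategy (Z U : Type*) [MeasurableSpace Z] [MeasurableSpace U] where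
  init : Measure U
  step : (n : ℕ) → Kernel ((i : Finset.Iic n) → Z) U
  isProbabilityMeasure_init : IsProbabilityMeasure init
  isMarkovKernel_step : ∀ n, IsMarkovKernel (step n)

attribute [instance] Strategy.isProbabilityMeasure_init Strategy.isMarkovKernel_step

/-- The strategy chooses each of its actions as a (measurable) function of the past. -/
def Strategy.IsDeterministic {Z U : Type*} [MeasurableSpace Z] [MeasurableSpace U]
    (s : Strategy Z U) : Prop :=
  (∃ u : U, s.init = Measure.dirac u) ∧
    ∀ n, ∃ (f : ((i : Finset.Iic n) → Z) → U) (hf : Measurable f),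
      s.step n = Kernel.deterministic f hf

section Game

variable {X Y : Type*} [MeasurableSpace X] [MeasurableSpace Y]

/-- Given the past, the two players draw their actions independently of each other. -/
def jointStep (σ : Strategy (X × Y) X) (τ : Strategy (X × Y) Y) (n : ℕ) :
    Kernel ((i : Finset.Iic n) → X × Y) (X × Y) :=
  σ.step n ×ₖ τ.step n

instance (σ : Strategy (X × Y) X) (τ : Strategy (X × Y) Y) (n : ℕ) :
    IsMarkovKernel (jointStep σ τ n) := by
  unfold jointStep; infer_instance

/-- The law of the infinite sequence of pairs of actions when the players use `σ` and `τ`. -/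
def play (σ : Strategy (X × Y) X) (τ : Strategy (X × Y) Y) : Measure (ℕ → X × Y) :=
  ((σ.init.prod τ.init).map (fun z (_ : Finset.Iic 0) => z)).bind
    (Kernel.traj (X := fun _ => X × Y) (jointStep σ τ) 0)

/-- The strategy `σ` of the first player drives the error `err T` (a function of the
play, and of the number `T` of rounds) to `0`, uniformly over the strategies of the second player:
for all `ε > 0` there is `T₀` such that against all strategies of the second player
`P {∀ T ≥ T₀, err T ≤ ε} ≥ 1 - ε`. -/
def DrivesToZero (err : ℕ → (ℕ → X × Y) → ENNReal) (σ : Strategy (X × Y) X) : Prop :=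
  ∀ ε : ℝ, 0 < ε → ∃ T₀ : ℕ, ∀ τ : Strategy (X × Y) Y,
    ENNReal.ofReal (1 - ε) ≤
      play σ τ {ω | ∀ T : ℕ, T₀ ≤ T → err T ω ≤ ENNReal.ofReal ε}

end Game

section Approachability

variable {A B : Type*} [Fintype A] [Fintype B] [MeasurableSpace A] [MeasurableSpace B]

/-! ### Approachability with a vector-valued payoff -/

section Vector

variable {V : Type*} [NormedAddCommGroup V] [NormedSpace ℝ V]

/-- The bilinear extension of a payoff function `m` to mixed actions. -/
def mixedExt (m : A → B → V) (x : stdSimplex ℝ A) (y : stdSimplex ℝ B) : V :=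
  ∑ a, ∑ b, ((x : A → ℝ) a * (y : B → ℝ) b) • m a b

/-- `(1 / T) ∑ m(x_t, y_t)`, the average payoff of the first `T` rounds. -/
def averagePayoff {X Y : Type*} (m : X → Y → V) (T : ℕ) (ω : ℕ → X × Y) : V :=
  (T : ℝ)⁻¹ • ∑ t ∈ Finset.range T, m (ω t).1 (ω t).2

/-- `σ` ensures that `S` is `m`-approached, pure actions being taken and observed. -/
def ApproachesPure (m : A → B → V) (S : Set V) (σ : Strategy (A × B) A) : Prop :=
  DrivesToZero (fun T ω => Metric.infEDist (averagePayoff m T ω) S) σ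

/-- `σ` ensures that `S` is `m`-approached, mixed actions being taken and observed. -/
def ApproachesMixed (m : A → B → V) (S : Set V)
    (σ : Strategy (stdSimplex ℝ A × stdSimplex ℝ B) (stdSimplex ℝ A)) : Prop :=
  DrivesToZero (fun T ω => Metric.infEDist (averagePayoff (mixedExt m) T ω) S) σ

/-- `S` is `m`-approachable with pure actions. -/
def ApproachablePure (m : A → B → V) (S : Set V) : Prop :=
  ∃ σ, ApproachesPure m S σ

/-- `S` is `m`-approachable with mixed actions. -/
def ApproachableMixed (m : A → B → V) (S : Set V) : Prop :=
  ∃ σ, ApproachesMixed m S σ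

end Vector

/-! ### Robust approachability with a set-valued payoff -/

section Joint

variable [DecidableEq A] [DecidableEq B]

/-- The Dirac mass at `(a, b)`; vectors indexed by `A × B` carry the `ℓ²`-norm. -/
def diracPayoff (a : A) (b : B) : EuclideanSpace ℝ (A × B) :=
  EuclideanSpace.single (a, b) 1

/-- `π_T`, the empirical distribution of the pairs of pure actions of the first `T` rounds. -/
def empiricalPure (T : ℕ) (ω : ℕ → A × B) : EuclideanSpace ℝ (A × B) :=
  (T : ℝ)⁻¹ • ∑ t ∈ Finset.range T, diracPayoff (ω t).1 (ω t).2

end Joint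

/-- The product distribution `x ⊗ y`. -/
def prodDist (x : stdSimplex ℝ A) (y : stdSimplex ℝ B) : EuclideanSpace ℝ (A × B) :=
  WithLp.toLp 2 (fun p => (x : A → ℝ) p.1 * (y : B → ℝ) p.2)

/-- `ν_T = (1 / T) ∑ x_t ⊗ y_t`, the empirical joint distribution of the mixed actions. -/
def empiricalMixed (T : ℕ) (ω : ℕ → stdSimplex ℝ A × stdSimplex ℝ B) :
    EuclideanSpace ℝ (A × B) :=
  (T : ℝ)⁻¹ • ∑ t ∈ Finset.range T, prodDist (ω t).1 (ω t).2

variable {d : ℕ}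

open scoped Pointwise in
/-- The linear extension `∑_{a,b} μ_{a,b} m̄(a, b)` of a set-valued payoff function (Minkowski sums
and dilations of sets). -/
def setExt (mbar : A → B → Set (EuclideanSpace ℝ (Fin d))) (μ : EuclideanSpace ℝ (A × B)) :
    Set (EuclideanSpace ℝ (Fin d)) :=
  ∑ a, ∑ b, μ (a, b) • mbar a b

/-- `sup_{s ∈ S} inf_{c ∈ C} ‖c - s‖`, as an extended nonnegative number. -/
def excess (S C : Set (EuclideanSpace ℝ (Fin d))) : ENNReal :=
  ⨆ s ∈ S, Metric.infEDist s C

/-- `σ` ensures that `C` is `m̄`-robust approached, pure actions being taken and observed. -/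
def RobustApproachesPure [DecidableEq A] [DecidableEq B]
    (mbar : A → B → Set (EuclideanSpace ℝ (Fin d)))
    (C : Set (EuclideanSpace ℝ (Fin d))) (σ : Strategy (A × B) A) : Prop :=
  DrivesToZero (fun T ω => excess (setExt mbar (empiricalPure T ω)) C) σ

/-- `σ` ensures that `C` is `m̄`-robust approached, mixed actions being taken and observed. -/
def RobustApproachesMixed (mbar : A → B → Set (EuclideanSpace ℝ (Fin d)))
    (C : Set (EuclideanSpace ℝ (Fin d)))
    (σ : Strategy (stdSimplex ℝ A × stdSimplex ℝ B) (stdSimplex ℝ A)) : Prop :=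
  DrivesToZero (fun T ω => excess (setExt mbar (empiricalMixed T ω)) C) σ

/-- `C` is `m̄`-robust approachable with pure actions. -/
def RobustApproachablePure [DecidableEq A] [DecidableEq B]
    (mbar : A → B → Set (EuclideanSpace ℝ (Fin d)))
    (C : Set (EuclideanSpace ℝ (Fin d))) : Prop :=
  ∃ σ, RobustApproachesPure mbar C σ

/-- `C` is `m̄`-robust approachable with mixed actions. -/
def RobustApproachableMixed (mbar : A → B → Set (EuclideanSpace ℝ (Fin d)))
    (C : Set (EuclideanSpace ℝ (Fin d))) : Prop :=
  ∃ σ : Strategy (stdSimplex ℝ A × stdSimplex ℝ B) (stdSimplex ℝ A),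
    RobustApproachesMixed mbar C σ

/-- The robust approachability condition (RAC). -/
def RAC (mbar : A → B → Set (EuclideanSpace ℝ (Fin d)))
    (C : Set (EuclideanSpace ℝ (Fin d))) : Prop :=
  ∀ y : stdSimplex ℝ B, ∃ x : stdSimplex ℝ A, setExt mbar (prodDist x y) ⊆ C

/-- The lifted target set `{μ ∈ Δ(A × B) : m̄(μ) ⊆ C}`. -/
def liftedSet (mbar : A → B → Set (EuclideanSpace ℝ (Fin d)))
    (C : Set (EuclideanSpace ℝ (Fin d))) : Set (EuclideanSpace ℝ (A × B)) :=
  {μ | WithLp.ofLp μ ∈ stdSimplex ℝ (A × B) ∧ setExt mbar μ ⊆ C}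

end Approachability

end

end RobustApproachability

/-! A point of the Minkowski combination `setExt mbar μ` is a value `linExt s μ` for some selection
`s` of `mbar`, so every statement about the set-valued payoff becomes a family of statements about
linear maps of `μ`, indexed by selections. Hence `liftedSet mbar C` is the simplex intersected with
linear preimages of `C`: it is closed and convex. All these maps share the Lipschitz constant `M
√(N_A N_B)`, so closeness of `μ` to the lifted set controls the excess over `C`. Both equivalences
follow from the cycle: (RAC), approachability of the lifted set, robust approachability of `C`,
(RAC).

From (RAC) to the lifted set: (RAC) is Blackwell's dual condition for the payoff `x ⊗ y`, and Sion's
minimax theorem turns it into the half-space condition. The first player then makes the inner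
product of the current error with the next step nonpositive in conditional mean, or at most a small
slack with mixed actions. The squared distance, multiplied by the squared number of rounds,
therefore grows at most linearly. With mixed actions this holds path by path. With pure actions a
compensated supermartingale and a maximal inequality give the bound uniform in time, and an
exponential moment through `cosh` gives the logarithmic dependence on `1 / δ`.

Back to (RAC): the second player draws independently with mean `y`. The mean of the empirical
distribution is then some `x ⊗ y`, and Jensen's inequality for the distance to `C` shows that this
`x` is almost good for all selections at once. Compactness of the simplex removes the error. -/

namespace RobustApproachability

noncomputable section

open scoped RealInnerProductSpace

/-! ### Set-valued payoffs as families of linear maps; the lifted set. -/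

section SetValued

variable {A B : Type*} [Fintype A] [Fintype B]

/-- The linear extension of a vector payoff to signed joint distributions. -/
def linExt {V : Type*} [AddCommGroup V] [Module ℝ V] (s : A → B → V) :
    EuclideanSpace ℝ (A × B) →ₗ[ℝ] V where
  toFun μ := ∑ a, ∑ b, μ (a, b) • s a b
  map_add' μ ν := by simp [add_smul, Finset.sum_add_distrib]
  map_smul' c μ := by simp [mul_smul, Finset.smul_sum]

theorem linExt_apply {V : Type*} [AddCommGroup V] [Module ℝ V] (s : A → B → V)
    (μ : EuclideanSpace ℝ (A × B)) : linExt s μ = ∑ a, ∑ b, μ (a, b) • s a b := rfl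

theorem continuous_linExt {V : Type*} [NormedAddCommGroup V] [NormedSpace ℝ V] (s : A → B → V) :
    Continuous (linExt s) :=
  LinearMap.continuous_of_finiteDimensional _

theorem norm_linExt_le_sum {V : Type*} [NormedAddCommGroup V] [NormedSpace ℝ V] {s : A → B → V}
    {M : ℝ} (hs : ∀ a b, ‖s a b‖ ≤ M) (μ : EuclideanSpace ℝ (A × B)) :
    ‖linExt s μ‖ ≤ M * ∑ p, |μ p| := by
  rw [linExt_apply, ← Fintype.sum_prod_type' (f := fun a b => μ (a, b) • s a b), Finset.mul_sum]
  refine (norm_sum_le _ _).trans (Finset.sum_le_sum fun p _ => ?_)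
  rw [norm_smul, Real.norm_eq_abs, mul_comm]
  exact mul_le_mul_of_nonneg_right (hs _ _) (abs_nonneg _)

theorem sum_abs_le_sqrt_card_mul_norm (μ : EuclideanSpace ℝ (A × B)) :
    ∑ p, |μ p| ≤ √((Fintype.card A : ℝ) * Fintype.card B) * ‖μ‖ := by
  rw [EuclideanSpace.norm_eq, ← Real.sqrt_mul (by positivity)]
  refine Real.le_sqrt_of_sq_le ?_
  have h := sq_sum_le_card_mul_sum_sq (s := Finset.univ) (f := fun p => |μ p|)
  simpa [Fintype.card_prod] using h

theorem norm_linExt_le {V : Type*} [NormedAddCommGroup V] [NormedSpace ℝ V] {s : A → B → V}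
    {M : ℝ} (hM : 0 ≤ M) (hs : ∀ a b, ‖s a b‖ ≤ M) (μ : EuclideanSpace ℝ (A × B)) :
    ‖linExt s μ‖ ≤ M * √((Fintype.card A : ℝ) * Fintype.card B) * ‖μ‖ := by
  rw [mul_assoc]
  exact (norm_linExt_le_sum hs μ).trans
    (mul_le_mul_of_nonneg_left (sum_abs_le_sqrt_card_mul_norm μ) hM)

variable {d : ℕ} {mbar : A → B → Set (EuclideanSpace ℝ (Fin d))}
  {C : Set (EuclideanSpace ℝ (Fin d))}

/-- Choosing a point in each summand of the Minkowski sum is choosing a selection. A value is needed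
even where the weight is zero, because `0 • ∅ = ∅`. -/
theorem mem_setExt {μ : EuclideanSpace ℝ (A × B)} {v : EuclideanSpace ℝ (Fin d)} :
    v ∈ setExt mbar μ ↔ ∃ s : A → B → EuclideanSpace ℝ (Fin d),
      (∀ a b, s a b ∈ mbar a b) ∧ linExt s μ = v := by
  simp only [setExt, Set.mem_fintype_sum]
  constructor
  · rintro ⟨g, hg, rfl⟩
    choose k hk hkg using hg
    choose s hs hsk using fun a b => Set.mem_smul_set.1 (hk a b)
    refine ⟨s, hs, ?_⟩
    rw [linExt_apply]
    refine Finset.sum_congr rfl fun a _ => ?_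
    rw [← hkg a]
    exact Finset.sum_congr rfl fun b _ => hsk a b
  · rintro ⟨s, hs, rfl⟩
    exact ⟨_, fun a => ⟨_, fun b => Set.smul_mem_smul_set (hs a b), rfl⟩, rfl⟩

theorem setExt_subset_iff {μ : EuclideanSpace ℝ (A × B)} :
    setExt mbar μ ⊆ C ↔ ∀ s : A → B → EuclideanSpace ℝ (Fin d),
      (∀ a b, s a b ∈ mbar a b) → linExt s μ ∈ C :=
  ⟨fun h s hs => h (mem_setExt.2 ⟨s, hs, rfl⟩), fun h v hv => by
    obtain ⟨s, hs, rfl⟩ := mem_setExt.1 hv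
    exact h s hs⟩

theorem excess_setExt_le_iff {μ : EuclideanSpace ℝ (A × B)} {r : ENNReal} :
    excess (setExt mbar μ) C ≤ r ↔ ∀ s : A → B → EuclideanSpace ℝ (Fin d),
      (∀ a b, s a b ∈ mbar a b) → Metric.infEDist (linExt s μ) C ≤ r := by
  simp only [excess, iSup_le_iff]
  exact ⟨fun h s hs => h _ (mem_setExt.2 ⟨s, hs, rfl⟩), fun h v hv => by
    obtain ⟨s, hs, rfl⟩ := mem_setExt.1 hv
    exact h s hs⟩

theorem liftedSet_eq_inter : liftedSet mbar C = WithLp.ofLp ⁻¹' stdSimplex ℝ (A × B) ∩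
    ⋂ s ∈ {s : A → B → EuclideanSpace ℝ (Fin d) | ∀ a b, s a b ∈ mbar a b}, linExt s ⁻¹' C := by
  ext μ
  simp [liftedSet, setExt_subset_iff]

theorem isClosed_liftedSet (hC : IsClosed C) : IsClosed (liftedSet mbar C) := by
  rw [liftedSet_eq_inter]
  exact ((isClosed_stdSimplex ℝ (A × B)).preimage (PiLp.continuous_ofLp 2 _)).inter
    (isClosed_biInter fun s _ => hC.preimage (continuous_linExt s))

theorem convex_liftedSet (hC : Convex ℝ C) : Convex ℝ (liftedSet mbar C) := by
  rw [liftedSet_eq_inter]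
  refine Convex.inter ?_ (convex_iInter₂ fun s _ => hC.linear_preimage (linExt s))
  exact (convex_stdSimplex ℝ (A × B)).linear_preimage
    (WithLp.linearEquiv 2 ℝ (A × B → ℝ)).toLinearMap

theorem excess_setExt_le [Nonempty A] [Nonempty B] {M : ℝ} (hM : 0 < M)
    (hbound : ∀ a b, ∀ s ∈ mbar a b, ‖s‖ ≤ M) (μ : EuclideanSpace ℝ (A × B)) :
    excess (setExt mbar μ) C ≤
      ENNReal.ofReal (M * √((Fintype.card A : ℝ) * Fintype.card B)) *
        Metric.infEDist μ (liftedSet mbar C) := by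
  have hK : 0 < M * √((Fintype.card A : ℝ) * Fintype.card B) := by positivity
  rw [excess_setExt_le_iff]
  intro s hs
  simp only [Metric.infEDist]
  -- The factor being neither `0` nor `∞`, it passes through the infimum even when the lifted set is
  -- empty and the infimum is `∞`.
  rw [ENNReal.mul_iInf_of_ne (by simpa using hK) ENNReal.ofReal_ne_top]
  refine le_iInf fun ν => ?_
  rw [ENNReal.mul_iInf_of_ne (by simpa using hK) ENNReal.ofReal_ne_top]
  refine le_iInf fun hν => ?_
  refine (iInf₂_le _ (setExt_subset_iff.1 hν.2 s hs)).trans ?_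
  rw [edist_dist, edist_dist, ← ENNReal.ofReal_mul hK.le, dist_eq_norm, dist_eq_norm, ← map_sub]
  exact ENNReal.ofReal_le_ofReal
    (norm_linExt_le hM.le (fun a b => hbound a b _ (hs a b)) _)

theorem prodDist_mem_stdSimplex (x : stdSimplex ℝ A) (y : stdSimplex ℝ B) :
    WithLp.ofLp (prodDist x y) ∈ stdSimplex ℝ (A × B) := by
  refine ⟨fun p => mul_nonneg (x.2.1 _) (y.2.1 _), ?_⟩
  simp only [prodDist]
  rw [Fintype.sum_prod_type' (f := fun a b => (x : A → ℝ) a * (y : B → ℝ) b),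
    ← Finset.sum_mul_sum, stdSimplex.sum_eq_one, stdSimplex.sum_eq_one, one_mul]

theorem RAC.exists_prodDist_mem (h : RAC mbar C) (y : stdSimplex ℝ B) :
    ∃ x : stdSimplex ℝ A, prodDist x y ∈ liftedSet mbar C :=
  let ⟨x, hx⟩ := h y
  ⟨x, prodDist_mem_stdSimplex x y, hx⟩

theorem diracPayoff_mem_stdSimplex [DecidableEq A] [DecidableEq B] (a : A) (b : B) :
    WithLp.ofLp (diracPayoff a b) ∈ stdSimplex ℝ (A × B) := by
  simpa [diracPayoff] using single_mem_stdSimplex ℝ (a, b)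

theorem mixedExt_diracPayoff [DecidableEq A] [DecidableEq B] :
    mixedExt (diracPayoff : A → B → EuclideanSpace ℝ (A × B)) = prodDist := by
  ext x y p
  rw [mixedExt, ← Fintype.sum_prod_type'
    (f := fun a b => ((x : A → ℝ) a * (y : B → ℝ) b) • diracPayoff a b)]
  simp [diracPayoff, prodDist, Finset.sum_apply, Pi.single_apply]

theorem norm_sq_le_one_of_mem_stdSimplex {ι : Type*} [Fintype ι] {μ : EuclideanSpace ℝ ι}
    (hμ : WithLp.ofLp μ ∈ stdSimplex ℝ ι) : ‖μ‖ ^ 2 ≤ 1 := by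
  rw [EuclideanSpace.norm_sq_eq, ← hμ.2]
  refine Finset.sum_le_sum fun i _ => ?_
  have h1 : μ i ≤ 1 := (mem_Icc_of_mem_stdSimplex hμ i).2
  have h0 : 0 ≤ μ i := hμ.1 i
  rw [Real.norm_of_nonneg h0]
  nlinarith

/-- Nonnegative coordinates make the inner product nonnegative, which gives `2` instead of the `4`
of the triangle inequality. This is the variance term of every rate below. -/
theorem norm_sub_sq_le_two {ι : Type*} [Fintype ι] {μ ν : EuclideanSpace ℝ ι}
    (hμ : WithLp.ofLp μ ∈ stdSimplex ℝ ι) (hν : WithLp.ofLp ν ∈ stdSimplex ℝ ι) :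
    ‖μ - ν‖ ^ 2 ≤ 2 := by
  have h : 0 ≤ inner ℝ μ ν := by
    rw [PiLp.inner_apply]
    exact Finset.sum_nonneg fun i _ => mul_nonneg (hν.1 i) (hμ.1 i)
  rw [norm_sub_sq_real]
  linarith [norm_sq_le_one_of_mem_stdSimplex hμ, norm_sq_le_one_of_mem_stdSimplex hν]

end SetValued

section Error

variable {X Y : Type*} [MeasurableSpace X] [MeasurableSpace Y]

theorem DrivesToZero.mono_of_le_mul {err err' : ℕ → (ℕ → X × Y) → ENNReal}
    {σ : Strategy (X × Y) X} (h : DrivesToZero err σ) {K : ℝ} (hK : 0 < K)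
    (hle : ∀ T ω, err' T ω ≤ ENNReal.ofReal K * err T ω) : DrivesToZero err' σ := by
  intro ε hε
  -- `ε` serves the probability and `ε / K` serves the error.
  obtain ⟨T₀, hT₀⟩ := h (min ε (ε / K)) (by positivity)
  refine ⟨T₀, fun τ => ?_⟩
  refine (ENNReal.ofReal_le_ofReal (by linarith [min_le_left ε (ε / K)])).trans
    ((hT₀ τ).trans (measure_mono fun ω hω T hT => ?_))
  calc err' T ω ≤ ENNReal.ofReal K * err T ω := hle T ω
    _ ≤ ENNReal.ofReal K * ENNReal.ofReal (ε / K) := by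
        gcongr
        exact (hω T hT).trans (ENNReal.ofReal_le_ofReal (min_le_right _ _))
    _ = ENNReal.ofReal ε := by
        rw [← ENNReal.ofReal_mul hK.le, mul_div_cancel₀ _ hK.ne']

end Error

/-! ### A convexity inequality for the exponential moment. -/

section Cosh

open Real

/-- As a function of `t ≥ 0`, `cosh √t` is a power series with nonnegative coefficients, hence
convex; the inequality is checked term by term. -/
theorem cosh_sqrt_convex_combination {u v p q : ℝ} (hp : 0 ≤ p) (hq : 0 ≤ q) (hpq : p + q = 1)
    {r : ℝ} (hr : r ^ 2 = p * u ^ 2 + q * v ^ 2) : cosh r ≤ p * cosh u + q * cosh v := by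
  refine hasSum_le (fun n => ?_) (hasSum_cosh r)
    (((hasSum_cosh u).mul_left p).add ((hasSum_cosh v).mul_left q))
  have h := (convexOn_pow (𝕜 := ℝ) n).2 (x := u ^ 2) (y := v ^ 2) (sq_nonneg u) (sq_nonneg v)
    hp hq hpq
  simp only [smul_eq_mul] at h
  rw [pow_mul, pow_mul, pow_mul, hr, ← mul_div_assoc, ← mul_div_assoc, ← add_div]
  gcongr

/-- `R² + 2c + b²` lies between `(R - b)²` and `(R + b)²`, and the chord of the convex function
`cosh √t` between them is affine in `c`. An affine bound can be averaged when only the mean of `c`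
is known to be nonpositive. If `R * b = 0`, then `c = 0` and the division by zero is harmless. -/
theorem cosh_le_of_sq_le {R b c r : ℝ} (hR : 0 ≤ R) (hb : 0 ≤ b) (hr : 0 ≤ r)
    (hc : |c| ≤ R * b) (h : r ^ 2 ≤ R ^ 2 + 2 * c + b ^ 2) :
    cosh r ≤ cosh R * cosh b + sinh R * sinh b / (R * b) * c := by
  have hmono : cosh r ≤ cosh √(R ^ 2 + 2 * c + b ^ 2) := by
    rw [cosh_le_cosh, abs_of_nonneg hr, abs_of_nonneg (sqrt_nonneg _)]
    exact le_sqrt_of_sq_le h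
  have hnn : 0 ≤ R ^ 2 + 2 * c + b ^ 2 := (sq_nonneg r).trans h
  refine hmono.trans ?_
  rcases eq_or_lt_of_le (mul_nonneg hR hb) with h0 | h0
  · have hc0 : c = 0 := abs_eq_zero.1 (le_antisymm (hc.trans h0.symm.le) (abs_nonneg c))
    rcases mul_eq_zero.1 h0.symm with rfl | rfl
    · simp [hc0, sqrt_sq hb]
    · simp [hc0, sqrt_sq hR]
  · obtain ⟨hc1, hc2⟩ := abs_le.1 hc
    set z := c / (R * b) with hz
    have hcz : c = z * (R * b) := by rw [hz, div_mul_cancel₀ _ h0.ne']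
    have hz1 : -1 ≤ z := by rw [hz, le_div_iff₀ h0]; linarith
    have hz2 : z ≤ 1 := by rw [hz, div_le_iff₀ h0]; linarith
    have hconv := cosh_sqrt_convex_combination (u := R + b) (v := R - b) (p := (1 + z) / 2)
      (q := (1 - z) / 2) (r := √(R ^ 2 + 2 * c + b ^ 2)) (by linarith) (by linarith) (by ring)
      (by rw [sq_sqrt hnn, hcz]; ring)
    rw [cosh_add, cosh_sub] at hconv
    refine hconv.trans (le_of_eq ?_)
    have e : sinh R * sinh b / (R * b) * c = sinh R * sinh b * z := by rw [hz]; ring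
    rw [e]
    ring

end Cosh

/-! ### Metric projections and Blackwell's one-step inequality. -/

section Projection

variable {E : Type*} [NormedAddCommGroup E] [InnerProductSpace ℝ E]

/-- `P` is the metric projection onto `D`. -/
structure IsMetricProj (D : Set E) (P : E → E) : Prop where
  mem : ∀ μ, P μ ∈ D
  inner_le : ∀ μ, ∀ q ∈ D, ⟪μ - P μ, q - P μ⟫ ≤ 0
  norm_le : ∀ μ, ∀ q ∈ D, ‖μ - P μ‖ ≤ ‖μ - q‖

theorem exists_isMetricProj [CompleteSpace E] {D : Set E} (hne : D.Nonempty) (hcl : IsClosed D)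
    (hconv : Convex ℝ D) : ∃ P, IsMetricProj D P := by
  choose P hPmem hP using exists_norm_eq_iInf_of_complete_convex hne hcl.isComplete hconv
  refine ⟨P, hPmem, fun μ => (norm_eq_iInf_iff_real_inner_le_zero hconv (hPmem μ)).1 (hP μ),
    fun μ q hq => ?_⟩
  rw [hP μ]
  exact ciInf_le ⟨0, Set.forall_mem_range.2 fun _ => norm_nonneg _⟩ (⟨q, hq⟩ : D)

variable {D : Set E} {P : E → E}

/-- Adding the variational inequalities at the two projections gives firm nonexpansiveness.
Continuity of `P` is what later makes the mixed strategy measurable. -/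
theorem IsMetricProj.lipschitzWith (hP : IsMetricProj D P) : LipschitzWith 1 P := by
  refine LipschitzWith.of_dist_le_mul fun μ ν => ?_
  rw [NNReal.coe_one, one_mul, dist_eq_norm, dist_eq_norm]
  have h1 := hP.inner_le μ _ (hP.mem ν)
  have h2 := hP.inner_le ν _ (hP.mem μ)
  have h3 : ‖P μ - P ν‖ ^ 2 ≤ ⟪μ - ν, P μ - P ν⟫ := by
    rw [← real_inner_self_eq_norm_sq]
    have e1 : ⟪P μ - P ν, P μ - P ν⟫ = ⟪μ - ν, P μ - P ν⟫ + ⟪μ - P μ, P ν - P μ⟫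
        + ⟪ν - P ν, P μ - P ν⟫ := by
      simp only [inner_sub_left, inner_sub_right]
      ring
    linarith
  have h4 := real_inner_le_norm (μ - ν) (P μ - P ν)
  by_contra! hlt
  have := norm_nonneg (μ - ν)
  nlinarith

theorem IsMetricProj.infEDist_le (hP : IsMetricProj D P) (μ : E) :
    Metric.infEDist μ D ≤ ENNReal.ofReal ‖μ - P μ‖ := by
  rw [← dist_eq_norm, ← edist_dist]
  exact Metric.infEDist_le_edist_of_mem (hP.mem μ)

/-- Blackwell's one-step inequality for the average `μ'` of `T` vectors of average `μ` and of the
vector `g`. -/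
theorem IsMetricProj.sq_le_step (hP : IsMetricProj D P) {μ μ' g : E} {T : ℕ}
    (h : (T + 1 : ℝ) • μ' = (T : ℝ) • μ + g) (hg : ‖g - P μ‖ ^ 2 ≤ 2) :
    ((T + 1) * ‖μ' - P μ'‖) ^ 2 ≤
      (T * ‖μ - P μ‖) ^ 2 + 2 * (T * ⟪μ - P μ, g - P μ⟫) + 2 := by
  have h1 : (T + 1) * ‖μ' - P μ'‖ ≤ ‖(T : ℝ) • (μ - P μ) + (g - P μ)‖ := by
    have e : (T : ℝ) • (μ - P μ) + (g - P μ) = (T + 1 : ℝ) • (μ' - P μ) := by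
      rw [smul_sub, smul_sub, h, add_smul, one_smul]
      abel
    rw [e, norm_smul, Real.norm_of_nonneg (by positivity)]
    gcongr
    exact hP.norm_le _ _ (hP.mem μ)
  calc ((T + 1) * ‖μ' - P μ'‖) ^ 2 ≤ ‖(T : ℝ) • (μ - P μ) + (g - P μ)‖ ^ 2 := by gcongr
    _ = (T * ‖μ - P μ‖) ^ 2 + 2 * (T * ⟪μ - P μ, g - P μ⟫) + ‖g - P μ‖ ^ 2 := by
      rw [norm_add_sq_real, real_inner_smul_left, norm_smul, Real.norm_of_nonneg (by positivity)]
    _ ≤ _ := by linarith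

end Projection

/-! ### From the dual condition to half-spaces, by minimax. -/

section Minimax

variable {A B : Type*} [Fintype A] [Fintype B]

theorem inner_prodDist (u : EuclideanSpace ℝ (A × B)) (x : stdSimplex ℝ A) (y : stdSimplex ℝ B) :
    ⟪u, prodDist x y⟫ = ∑ b, (y : B → ℝ) b * ∑ a, (x : A → ℝ) a * u (a, b) := by
  rw [PiLp.inner_apply]
  simp only [prodDist, RCLike.inner_apply, conj_trivial]
  rw [Fintype.sum_prod_type' (f := fun a b => (x : A → ℝ) a * (y : B → ℝ) b * u (a, b)),
    Finset.sum_comm]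
  refine Finset.sum_congr rfl fun b _ => ?_
  rw [Finset.mul_sum]
  exact Finset.sum_congr rfl fun a _ => by ring

theorem inner_prodDist_le {u : EuclideanSpace ℝ (A × B)} {x : stdSimplex ℝ A} {c : ℝ}
    (h : ∀ b, ∑ a, (x : A → ℝ) a * u (a, b) ≤ c) (y : stdSimplex ℝ B) :
    ⟪u, prodDist x y⟫ ≤ c := by
  rw [inner_prodDist]
  calc _ ≤ ∑ b, (y : B → ℝ) b * c :=
        Finset.sum_le_sum fun b _ => mul_le_mul_of_nonneg_left (h b) (y.2.1 b)
    _ = c := by rw [← Finset.sum_mul, stdSimplex.sum_eq_one, one_mul]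

variable [Nonempty A] [Nonempty B]

theorem exists_saddlePoint (u : A × B → ℝ) : ∃ (x : stdSimplex ℝ A) (y : stdSimplex ℝ B),
    ∀ (x' : stdSimplex ℝ A) (b : B), ∑ a, (x : A → ℝ) a * u (a, b) ≤
      ∑ b, (y : B → ℝ) b * ∑ a, (x' : A → ℝ) a * u (a, b) := by
  classical
  let f : (A → ℝ) →ₗ[ℝ] (B → ℝ) →ₗ[ℝ] ℝ := LinearMap.mk₂ ℝ
    (fun x y => ∑ b, y b * ∑ a, x a * u (a, b))
    (fun x x' y => by simp [add_mul, mul_add, Finset.sum_add_distrib])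
    (fun c x y => by
      simp only [Finset.mul_sum, smul_eq_mul, Pi.smul_apply]
      exact Finset.sum_congr rfl fun _ _ => Finset.sum_congr rfl fun _ _ => by ring)
    (fun x y y' => by simp [add_mul, Finset.sum_add_distrib])
    (fun c x y => by simp [Finset.mul_sum, mul_assoc])
  have hf : ∀ x y, f x y = ∑ b, y b * ∑ a, x a * u (a, b) := fun _ _ => rfl
  have hcont₁ : ∀ y, Continuous fun x => f x y := fun y => by
    simp only [hf]; fun_prop
  have hcont₂ : ∀ x, Continuous fun y => f x y := fun x => by
    simp only [hf]; fun_prop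
  obtain ⟨x, hx, y, hy, hxy⟩ := Sion.exists_isSaddlePointOn (X := stdSimplex ℝ A)
    (Y := stdSimplex ℝ B) (f := fun x y => f x y)
    (Set.nonempty_coe_sort.1 inferInstance) (convex_stdSimplex ℝ A) (isCompact_stdSimplex ℝ A)
    (fun y _ => (hcont₁ y).lowerSemicontinuous.lowerSemicontinuousOn _)
    (fun y _ => ((f.flip y).convexOn (convex_stdSimplex ℝ A)).quasiconvexOn)
    (convex_stdSimplex ℝ B) (Set.nonempty_coe_sort.1 inferInstance) (isCompact_stdSimplex ℝ B)
    (fun x _ => (hcont₂ x).upperSemicontinuous.upperSemicontinuousOn _)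
    (fun x _ => ((f x).concaveOn (convex_stdSimplex ℝ B)).quasiconcaveOn)
  refine ⟨⟨x, hx⟩, ⟨y, hy⟩, fun x' b => ?_⟩
  -- The maximizer deviates to the vertex `b`, and the minimizer to `x'`.
  have h := hxy x'.1 x'.2 (Pi.single b 1) (single_mem_stdSimplex ℝ b)
  simp only [hf, Pi.single_apply, ite_mul, one_mul, zero_mul, Finset.sum_ite_eq',
    Finset.mem_univ, if_true] at h
  exact h

/-- Blackwell's condition for a half-space containing `D` follows from its dual form. -/
theorem exists_forall_sum_le {D : Set (EuclideanSpace ℝ (A × B))}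
    (hD : ∀ y : stdSimplex ℝ B, ∃ x : stdSimplex ℝ A, prodDist x y ∈ D)
    (u : EuclideanSpace ℝ (A × B)) {c : ℝ} (hu : ∀ q ∈ D, ⟪u, q⟫ ≤ c) :
    ∃ x : stdSimplex ℝ A, ∀ b, ∑ a, (x : A → ℝ) a * u (a, b) ≤ c := by
  obtain ⟨x, y, hxy⟩ := exists_saddlePoint (fun p => u p)
  obtain ⟨x', hx'⟩ := hD y
  -- The comparison action `x'` answers the optimal `y` of the second player, so `x' ⊗ y` lies in
  -- `D` and bounds the value of the game by `c`.
  refine ⟨x, fun b => (hxy x' b).trans ?_⟩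
  rw [← inner_prodDist]
  exact hu _ hx'

end Minimax

/-! ### Finite histories, the law of the play, and supermartingales along it. -/

section History

variable {Z : Type*} [Nonempty Z]

/-- A play that extends a finite history. -/
def extendHistory (n : ℕ) (h : (i : Finset.Iic n) → Z) : ℕ → Z :=
  fun t => if ht : t ∈ Finset.Iic n then h ⟨t, ht⟩ else Classical.arbitrary _

theorem frestrictLe_extendHistory {n : ℕ} (h : (i : Finset.Iic n) → Z) :
    Preorder.frestrictLe (π := fun _ => Z) n (extendHistory n h) = h := by
  ext1 ⟨i, hi⟩
  simp only [Preorder.frestrictLe_apply, extendHistory]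
  exact dif_pos hi

theorem eq_extendHistory_of_dependsOn {β : Type*} {Φ : (ℕ → Z) → β} {n : ℕ}
    (hΦ : DependsOn Φ (Set.Iic n)) (ω : ℕ → Z) :
    Φ ω = Φ (extendHistory n (Preorder.frestrictLe (π := fun _ => Z) n ω)) :=
  hΦ fun i hi => by
    have hi' : i ∈ Finset.Iic n := by simpa using hi
    simp only [extendHistory, dif_pos hi']
    rfl

end History

section Play

variable {X Y : Type*} [MeasurableSpace X] [MeasurableSpace Y]

theorem play_eq_trajMeasure (σ : Strategy (X × Y) X) (τ : Strategy (X × Y) Y) :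
    play σ τ = Kernel.trajMeasure (X := fun _ => X × Y) (σ.init.prod τ.init) (jointStep σ τ) := by
  rw [play, Kernel.trajMeasure]
  congr 2

instance (σ : Strategy (X × Y) X) (τ : Strategy (X × Y) Y) :
    IsProbabilityMeasure (play σ τ) := by
  rw [play_eq_trajMeasure]; infer_instance

theorem compProd_play (σ : Strategy (X × Y) X) (τ : Strategy (X × Y) Y) (n : ℕ) :
    (play σ τ).map (Preorder.frestrictLe (π := fun _ => X × Y) n) ⊗ₘ jointStep σ τ n =
      (play σ τ).map (fun ω => (Preorder.frestrictLe (π := fun _ => X × Y) n ω, ω (n + 1))) := by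
  rw [play_eq_trajMeasure]
  exact Kernel.map_frestrictLe_trajMeasure_compProd_eq_map_trajMeasure

theorem map_zero_play (σ : Strategy (X × Y) X) (τ : Strategy (X × Y) Y) :
    (play σ τ).map (fun ω => ω 0) = σ.init.prod τ.init := by
  have h : (fun ω : ℕ → X × Y => ω 0) =
      (fun h : (i : Finset.Iic 0) → X × Y => h ⟨0, by simp⟩) ∘
        Preorder.frestrictLe (π := fun _ => X × Y) 0 := rfl
  have hm : Measurable (fun z (_ : Finset.Iic 0) => z : X × Y → (Finset.Iic 0 → X × Y)) :=
    measurable_pi_lambda _ fun _ => measurable_id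
  rw [h, ← Measure.map_map (by fun_prop) (by fun_prop), play, Measure.map_comp _ _ (by fun_prop),
    Kernel.traj_map_frestrictLe, Kernel.partialTraj_self, Measure.id_comp,
    Measure.map_map (by fun_prop) hm]
  exact Measure.map_id

theorem map_succ_play (σ : Strategy (X × Y) X) (τ : Strategy (X × Y) Y) (n : ℕ) :
    (play σ τ).map (fun ω => ω (n + 1)) =
      ((play σ τ).map (Preorder.frestrictLe (π := fun _ => X × Y) n)).bind (jointStep σ τ n) := by
  have h : (play σ τ).map (fun ω => ω (n + 1)) =
      ((play σ τ).map (fun ω => (Preorder.frestrictLe (π := fun _ => X × Y) n ω, ω (n + 1)))).snd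
      := by
    rw [Measure.snd, Measure.map_map (by fun_prop) (by fun_prop)]
    rfl
  rw [h, ← compProd_play, Measure.snd_compProd]

theorem ae_play_succ {σ : Strategy (X × Y) X} {τ : Strategy (X × Y) Y} {n : ℕ}
    {p : ((i : Finset.Iic n) → X × Y) × (X × Y) → Prop} (hp : MeasurableSet {z | p z})
    (h : ∀ h, ∀ᵐ z ∂jointStep σ τ n h, p (h, z)) :
    ∀ᵐ ω ∂play σ τ, p (Preorder.frestrictLe (π := fun _ => X × Y) n ω, ω (n + 1)) := by
  have h1 : ∀ᵐ z ∂((play σ τ).map (Preorder.frestrictLe (π := fun _ => X × Y) n) ⊗ₘ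
      jointStep σ τ n), p z :=
    Measure.ae_compProd_of_ae_ae hp (Filter.Eventually.of_forall h)
  rw [compProd_play] at h1
  exact ae_of_ae_map (by fun_prop) h1

section Finite

variable [Finite X] [Finite Y] [DiscreteMeasurableSpace X] [DiscreteMeasurableSpace Y]

/-- There are finitely many histories of each length, so any function of a history is measurable and
bounded. -/
theorem integrable_of_dependsOn {σ : Strategy (X × Y) X} {τ : Strategy (X × Y) Y}
    {Φ : (ℕ → X × Y) → ℝ} {n : ℕ} (hΦ : DependsOn Φ (Set.Iic n)) : Integrable Φ (play σ τ) := by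
  have : Nonempty (X × Y) := (nonempty_of_isProbabilityMeasure (play σ τ)).map (fun ω => ω 0)
  have e : Φ = (fun h => Φ (extendHistory n h)) ∘ Preorder.frestrictLe (π := fun _ => X × Y) n :=
    funext fun ω => eq_extendHistory_of_dependsOn hΦ ω
  rw [e]
  exact (integrable_map_measure (Measurable.of_discrete.aestronglyMeasurable)
    (by fun_prop)).1 .of_finite

/-- Conditional expectations given the past can be bounded history by history. -/
theorem integral_play_succ_le {σ : Strategy (X × Y) X} {τ : Strategy (X × Y) Y} {n : ℕ}
    {Φ Ψ : (ℕ → X × Y) → ℝ} (hΦ : DependsOn Φ (Set.Iic (n + 1))) (hΨ : DependsOn Ψ (Set.Iic n))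
    (h : ∀ ω, ∫ z, Φ (Function.update ω (n + 1) z)
      ∂jointStep σ τ n (Preorder.frestrictLe (π := fun _ => X × Y) n ω) ≤ Ψ ω) :
    ∫ ω, Φ ω ∂play σ τ ≤ ∫ ω, Ψ ω ∂play σ τ := by
  have : Nonempty (X × Y) := (nonempty_of_isProbabilityMeasure (play σ τ)).map (fun ω => ω 0)
  let r := Preorder.frestrictLe (π := fun _ : ℕ => X × Y) n
  let F : ((i : Finset.Iic n) → X × Y) × (X × Y) → ℝ :=
    fun p => Φ (Function.update (extendHistory n p.1) (n + 1) p.2)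
  have hF : ∀ ω, Φ ω = F (r ω, ω (n + 1)) := fun ω => hΦ fun i hi => by
    rcases eq_or_ne i (n + 1) with rfl | hne
    · simp
    · have hi' : i ∈ Finset.Iic n := by simp at hi ⊢; omega
      simp only [Function.update_of_ne hne, extendHistory, dif_pos hi']
      rfl
  have hr : Measurable r := by fun_prop
  calc ∫ ω, Φ ω ∂play σ τ = ∫ ω, F (r ω, ω (n + 1)) ∂play σ τ := by simp only [hF]
    _ = ∫ p, F p ∂((play σ τ).map r ⊗ₘ jointStep σ τ n) := by
      rw [compProd_play, integral_map (by fun_prop) Measurable.of_discrete.aestronglyMeasurable]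
    _ = ∫ h, ∫ z, F (h, z) ∂jointStep σ τ n h ∂(play σ τ).map r :=
      Measure.integral_compProd .of_finite
    _ ≤ ∫ h, Ψ (extendHistory n h) ∂(play σ τ).map r := by
      refine integral_mono .of_finite .of_finite fun h' => ?_
      have := h (extendHistory n h')
      rwa [frestrictLe_extendHistory] at this
    _ = ∫ ω, Ψ ω ∂play σ τ := by
      rw [integral_map hr.aemeasurable Measurable.of_discrete.aestronglyMeasurable]
      exact integral_congr_ae (Filter.Eventually.of_forall fun ω =>
        (eq_extendHistory_of_dependsOn hΨ ω).symm)

/-- The maximal inequality for nonnegative supermartingales. -/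
theorem measureReal_exists_ge_le {σ : Strategy (X × Y) X} {τ : Strategy (X × Y) Y} {m : ℕ}
    {V : ℕ → (ℕ → X × Y) → ℝ} (hV : ∀ n, DependsOn (V n) (Set.Iic n)) (hV0 : ∀ n ω, 0 ≤ V n ω)
    (h : ∀ n, m ≤ n → ∀ ω, ∫ z, V (n + 1) (Function.update ω (n + 1) z)
      ∂jointStep σ τ n (Preorder.frestrictLe (π := fun _ => X × Y) n ω) ≤ V n ω)
    {c : ℝ} (hc : 0 < c) :
    (play σ τ).real {ω | ∃ n, m ≤ n ∧ c ≤ V n ω} ≤ (∫ ω, V m ω ∂play σ τ) / c := by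
  classical
  -- `G n` says that the level `c` has not been reached before `n`. `U` follows `V` up to the first
  -- passage, then is set to `c`, which can only lower it, so the supermartingale inequality
  -- survives.
  let G : ℕ → (ℕ → X × Y) → Prop := fun n ω => ∀ j, m ≤ j → j < n → V j ω < c
  let U : ℕ → (ℕ → X × Y) → ℝ := fun n ω => if G n ω then V n ω else c
  have hG : ∀ n ω ω', (∀ i ∈ Set.Iic n, ω i = ω' i) → (G n ω ↔ G n ω') := by
    intro n ω ω' hω
    refine forall_congr' fun j => imp_congr_right fun _ => imp_congr_right fun hj => ?_
    rw [hV j (fun i hi => hω i (le_trans hi hj.le))]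
  have hU : ∀ n, DependsOn (U n) (Set.Iic n) := by
    intro n ω ω' hω
    simp only [U, hG n ω ω' hω, hV n hω]
  have hstep : ∀ n, m ≤ n → ∫ ω, U (n + 1) ω ∂play σ τ ≤ ∫ ω, U n ω ∂play σ τ := by
    intro n hn
    refine integral_play_succ_le (hU _) (hU _) fun ω => ?_
    have hupd : ∀ z, ∀ i ∈ Set.Iic n, Function.update ω (n + 1) z i = ω i := fun z i hi =>
      Function.update_of_ne (by simp at hi; omega) _ _
    have hGn : ∀ z, G (n + 1) (Function.update ω (n + 1) z) ↔ G n ω ∧ V n ω < c := by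
      intro z
      rw [← hG n _ _ (hupd z), ← hV n (hupd z)]
      exact ⟨fun H => ⟨fun j h1 h2 => H j h1 (by omega), H n hn (by omega)⟩,
        fun H j h1 h2 => (Nat.lt_succ_iff_lt_or_eq.1 h2).elim (H.1 j h1) (fun e => e ▸ H.2)⟩
    simp only [U, hGn]
    by_cases h1 : G n ω
    · by_cases h2 : V n ω < c
      · simpa [h1, h2] using h n hn ω
      · simpa [h1, h2] using not_lt.1 h2
    · simp [h1]
  have hUm : ∀ n, m ≤ n → ∫ ω, U n ω ∂play σ τ ≤ ∫ ω, V m ω ∂play σ τ := by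
    intro n hn
    induction n, hn using Nat.le_induction with
    | base =>
      refine le_of_eq (integral_congr_ae (Filter.Eventually.of_forall fun ω => ?_))
      exact if_pos fun j h1 h2 => absurd h1 (not_le.2 h2)
    | succ n hn ih => exact (hstep n hn).trans ih
  have hbad : ∀ n, m ≤ n → (play σ τ).real {ω | ¬ G n ω} ≤ (∫ ω, V m ω ∂play σ τ) / c := by
    intro n hn
    rw [le_div_iff₀ hc, mul_comm]
    refine le_trans (le_trans ?_ (mul_meas_ge_le_integral_of_nonneg (f := U n) ?_
      (integrable_of_dependsOn (hU n)) c)) (hUm n hn)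
    · refine mul_le_mul_of_nonneg_left (measureReal_mono fun ω hω => ?_) hc.le
      have e : U n ω = c := if_neg hω
      exact e.ge
    · exact Filter.Eventually.of_forall fun ω => by
        simp only [U, Pi.zero_apply]
        split_ifs
        exacts [hV0 _ _, hc.le]
  have hmono : Monotone fun n => {ω | ¬ G n ω} := by
    intro n n' hnn' ω hω hG'
    exact hω fun j h1 h2 => hG' j h1 (h2.trans_le hnn')
  -- The bound on `¬ G n` is uniform in `n`, so it passes to the increasing union, where the level
  -- is reached at some time.
  have hlim := tendsto_measure_iUnion_atTop (μ := play σ τ) hmono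
  have hlim' := (ENNReal.tendsto_toReal (measure_ne_top _ _)).comp hlim
  refine le_trans (measureReal_mono ?_) (le_of_tendsto hlim'
    (Filter.eventually_atTop.2 ⟨m, fun n hn => hbad n hn⟩))
  rintro ω ⟨n, hn, hcn⟩
  exact Set.mem_iUnion.2 ⟨n + 1, fun hG' => not_lt.2 hcn (hG' n hn (Nat.lt_succ_self n))⟩

end Finite

end Play

/-! ### Average payoffs. -/

section Average

variable {X Y V : Type*} [NormedAddCommGroup V] [NormedSpace ℝ V] {g : X → Y → V}

theorem smul_averagePayoff (T : ℕ) (ω : ℕ → X × Y) :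
    (T : ℝ) • averagePayoff g T ω = ∑ t ∈ Finset.range T, g (ω t).1 (ω t).2 := by
  rcases Nat.eq_zero_or_pos T with rfl | hT
  · simp
  · rw [averagePayoff, smul_inv_smul₀ (by positivity)]

theorem succ_smul_averagePayoff (T : ℕ) (ω : ℕ → X × Y) :
    (T + 1 : ℝ) • averagePayoff g (T + 1) ω =
      (T : ℝ) • averagePayoff g T ω + g (ω T).1 (ω T).2 := by
  have h := smul_averagePayoff (g := g) (T + 1) ω
  rw [Finset.sum_range_succ, ← smul_averagePayoff T ω] at h
  exact_mod_cast h

theorem dependsOn_averagePayoff (n : ℕ) : DependsOn (averagePayoff g (n + 1)) (Set.Iic n) := by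
  intro ω ω' h
  rw [averagePayoff, averagePayoff]
  congr 1
  refine Finset.sum_congr rfl fun t ht => ?_
  rw [h t (by simp at ht ⊢; omega)]

theorem averagePayoff_update (n : ℕ) (ω : ℕ → X × Y) (z : X × Y) :
    averagePayoff g (n + 1) (Function.update ω (n + 1) z) = averagePayoff g (n + 1) ω :=
  dependsOn_averagePayoff n fun i hi => Function.update_of_ne (by simp at hi; omega) _ _

theorem averagePayoff_mem_convex {K : Set V} (hK : Convex ℝ K) (hg : ∀ x y, g x y ∈ K) (n : ℕ)
    (ω : ℕ → X × Y) : averagePayoff g (n + 1) ω ∈ K := by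
  rw [averagePayoff, Finset.smul_sum]
  refine hK.sum_mem (fun _ _ => by positivity) ?_ fun _ _ => hg _ _
  rw [Finset.sum_const, Finset.card_range, nsmul_eq_mul, mul_inv_cancel₀ (by positivity)]

end Average

/-! ### Mixed actions as probability measures. -/

section RandomizedStrategy

variable {A : Type*} [Fintype A] [MeasurableSpace A]

/-- The probability measure on a finite set given by a point of the simplex. -/
def simplexMeasure (x : stdSimplex ℝ A) : Measure A :=
  ∑ a, ENNReal.ofReal ((x : A → ℝ) a) • Measure.dirac a

instance (x : stdSimplex ℝ A) : IsProbabilityMeasure (simplexMeasure x) where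
  measure_univ := by
    simp only [simplexMeasure, Measure.coe_finsetSum, Finset.sum_apply, Measure.smul_apply,
      measure_univ, smul_eq_mul, mul_one]
    rw [← ENNReal.ofReal_sum_of_nonneg (f := fun a => (x : A → ℝ) a) fun a _ => x.2.1 a]
    simp

theorem simplexMeasure_real_singleton [DiscreteMeasurableSpace A] (x : stdSimplex ℝ A) (a : A) :
    (simplexMeasure x).real {a} = (x : A → ℝ) a := by
  classical
  have h : simplexMeasure x {a} = ENNReal.ofReal ((x : A → ℝ) a) := by
    simp [simplexMeasure, Measure.dirac_apply' _ (measurableSet_singleton a), Set.indicator_apply]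
  rw [Measure.real, h, ENNReal.toReal_ofReal (r := (x : A → ℝ) a) (x.2.1 a)]

/-- The point of the simplex given by a probability measure on a finite set. -/
def simplexOfMeasure [DiscreteMeasurableSpace A] (κ : Measure A) [IsProbabilityMeasure κ] :
    stdSimplex ℝ A :=
  ⟨fun a => κ.real {a}, fun _ => measureReal_nonneg, by
    rw [sum_measureReal_singleton, Finset.coe_univ, probReal_univ]⟩

theorem simplexOfMeasure_apply [DiscreteMeasurableSpace A] (κ : Measure A)
    [IsProbabilityMeasure κ] (a : A) : (simplexOfMeasure κ : A → ℝ) a = κ.real {a} := rfl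

theorem integral_diracPayoff_prod {B : Type*} [Fintype B] [MeasurableSpace B]
    [DiscreteMeasurableSpace A] [DiscreteMeasurableSpace B] [DecidableEq A] [DecidableEq B]
    (κ : Measure A) (κ' : Measure B) [IsProbabilityMeasure κ] [IsProbabilityMeasure κ'] :
    ∫ z, diracPayoff z.1 z.2 ∂κ.prod κ' =
      prodDist (simplexOfMeasure κ) (simplexOfMeasure κ') := by
  rw [integral_fintype .of_finite]
  ext p
  simp only [diracPayoff, prodDist, simplexOfMeasure_apply, smul_eq_mul,
    WithLp.ofLp_sum, Finset.sum_apply, WithLp.ofLp_smul, Pi.smul_apply]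
  rw [Finset.sum_eq_single p]
  · simp only [Prod.mk.eta, PiLp.single_apply, if_true, mul_one]
    rw [← measureReal_prod_prod, Set.singleton_prod_singleton]
  · intro q _ hq
    simp [hq.symm]
  · simp

variable {B : Type*} [Finite B] [MeasurableSpace B] [DiscreteMeasurableSpace A]
  [DiscreteMeasurableSpace B]

/-- The strategy that draws its actions according to mixed actions that depend on the past. -/
def randomizedStrategy (x₀ : stdSimplex ℝ A)
    (f : (n : ℕ) → ((i : Finset.Iic n) → A × B) → stdSimplex ℝ A) : Strategy (A × B) A where
  init := simplexMeasure x₀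
  step n := ⟨fun h => simplexMeasure (f n h), .of_discrete⟩
  isProbabilityMeasure_init := inferInstance
  isMarkovKernel_step _ := ⟨fun _ => inferInstanceAs (IsProbabilityMeasure (simplexMeasure _))⟩

end RandomizedStrategy

/-! ### Distance of the empirical distribution to the target, pure actions. -/

section ProjDist

variable {A B : Type*} [Fintype A] [Fintype B] [DecidableEq A] [DecidableEq B]
    {D : Set (EuclideanSpace ℝ (A × B))}
    {P : EuclideanSpace ℝ (A × B) → EuclideanSpace ℝ (A × B)}

/-- The distance of the average payoff after `n + 1` rounds to its projection. -/
def projDist (P : EuclideanSpace ℝ (A × B) → EuclideanSpace ℝ (A × B)) (n : ℕ) (ω : ℕ → A × B) :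
    ℝ :=
  ‖empiricalPure (n + 1) ω - P (empiricalPure (n + 1) ω)‖

theorem projDist_nonneg (n : ℕ) (ω : ℕ → A × B) : 0 ≤ projDist P n ω := norm_nonneg _

theorem dependsOn_projDist (n : ℕ) : DependsOn (projDist P n) (Set.Iic n) := fun ω ω' h => by
  have : empiricalPure (n + 1) ω = empiricalPure (n + 1) ω' :=
    dependsOn_averagePayoff (g := diracPayoff) n h
  rw [projDist, projDist, this]

variable (hP : IsMetricProj D P) (hD : ∀ q ∈ D, WithLp.ofLp q ∈ stdSimplex ℝ (A × B))
include hP hD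

theorem projDist_zero_sq_le (ω : ℕ → A × B) : projDist P 0 ω ^ 2 ≤ 2 := by
  have h := averagePayoff_mem_convex (g := diracPayoff)
    ((convex_stdSimplex ℝ (A × B)).linear_preimage
      (WithLp.linearEquiv 2 ℝ (A × B → ℝ)).toLinearMap) diracPayoff_mem_stdSimplex 0 ω
  exact norm_sub_sq_le_two h (hD _ (hP.mem _))

theorem projDist_update_sq_le (n : ℕ) (ω : ℕ → A × B) (z : A × B) :
    ((n + 2) * projDist P (n + 1) (Function.update ω (n + 1) z)) ^ 2 ≤
      ((n + 1) * projDist P n ω) ^ 2 + 2 * ((n + 1) *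
        ⟪empiricalPure (n + 1) ω - P (empiricalPure (n + 1) ω),
          diracPayoff z.1 z.2 - P (empiricalPure (n + 1) ω)⟫) + 2 := by
  have h := succ_smul_averagePayoff (g := diracPayoff) (n + 1) (Function.update ω (n + 1) z)
  rw [averagePayoff_update, Function.update_self] at h
  have h' := hP.sq_le_step h
    (norm_sub_sq_le_two (diracPayoff_mem_stdSimplex z.1 z.2) (hD _ (hP.mem _)))
  have e : ((n + 1 : ℕ) : ℝ) + 1 = n + 2 := by push_cast; ring
  rw [e] at h'
  push_cast at h'
  exact h'

theorem abs_inner_le_mul_sqrt_two {μ : EuclideanSpace ℝ (A × B)} (z : A × B) :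
    |⟪μ - P μ, diracPayoff z.1 z.2 - P μ⟫| ≤ ‖μ - P μ‖ * √2 := by
  refine (abs_real_inner_le_norm _ _).trans ?_
  gcongr
  exact Real.le_sqrt_of_sq_le
    (norm_sub_sq_le_two (diracPayoff_mem_stdSimplex z.1 z.2) (hD _ (hP.mem _)))

end ProjDist

/-! ### Blackwell's strategy with pure actions: second and exponential moments. -/

section Blackwell

variable {A B : Type*} [Fintype A] [Fintype B] [MeasurableSpace A] [MeasurableSpace B]
    [DiscreteMeasurableSpace A] [DiscreteMeasurableSpace B] [DecidableEq A] [DecidableEq B]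
    {D : Set (EuclideanSpace ℝ (A × B))}
    {P : EuclideanSpace ℝ (A × B) → EuclideanSpace ℝ (A × B)}

/-- Against `σ`, the conditional expectation of the next payoff is separated by a hyperplane from
the current average. -/
def IsBlackwell (P : EuclideanSpace ℝ (A × B) → EuclideanSpace ℝ (A × B))
    (σ : Strategy (A × B) A) : Prop :=
  ∀ (τ : Strategy (A × B) B) (n : ℕ) (ω : ℕ → A × B),
    ∫ z, ⟪empiricalPure (n + 1) ω - P (empiricalPure (n + 1) ω),
        diracPayoff z.1 z.2 - P (empiricalPure (n + 1) ω)⟫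
      ∂jointStep σ τ n (Preorder.frestrictLe (π := fun _ => A × B) n ω) ≤ 0

/-- The half-space through `P μ` with normal `μ - P μ` contains `D`, so minimax provides a mixed
action that keeps the conditional mean payoff in it whatever the opponent does. Histories are
discrete, so an arbitrary choice of such actions is measurable; the first action is immaterial. -/
theorem exists_isBlackwell [Nonempty A] [Nonempty B] (hP : IsMetricProj D P)
    (hD : ∀ y : stdSimplex ℝ B, ∃ x : stdSimplex ℝ A, prodDist x y ∈ D) :
    ∃ σ : Strategy (A × B) A, IsBlackwell P σ := by
  have hsel : ∀ μ : EuclideanSpace ℝ (A × B), ∃ x : stdSimplex ℝ A, ∀ y : stdSimplex ℝ B,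
      ⟪μ - P μ, prodDist x y - P μ⟫ ≤ 0 := by
    intro μ
    obtain ⟨x, hx⟩ := exists_forall_sum_le hD (μ - P μ) (c := ⟪μ - P μ, P μ⟫) fun q hq => by
      have := hP.inner_le μ q hq
      rw [inner_sub_right] at this
      linarith
    refine ⟨x, fun y => ?_⟩
    have := inner_prodDist_le hx y
    rw [inner_sub_right]
    linarith
  choose sel hsel using hsel
  refine ⟨randomizedStrategy (Classical.arbitrary _) fun n h =>
    sel (empiricalPure (n + 1) (extendHistory n h)), fun τ n ω => ?_⟩
  have hμ : empiricalPure (n + 1) (extendHistory n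
      (Preorder.frestrictLe (π := fun _ => A × B) n ω)) = empiricalPure (n + 1) ω :=
    (eq_extendHistory_of_dependsOn (dependsOn_averagePayoff (g := diracPayoff) n) ω).symm
  set μ := empiricalPure (n + 1) ω
  have hκ : jointStep (randomizedStrategy (Classical.arbitrary _) fun n h =>
      sel (empiricalPure (n + 1) (extendHistory n h))) τ n
        (Preorder.frestrictLe (π := fun _ => A × B) n ω) =
      (simplexMeasure (sel μ)).prod
        (τ.step n (Preorder.frestrictLe (π := fun _ => A × B) n ω)) := by
    rw [jointStep, Kernel.prod_apply, ← hμ]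
    rfl
  rw [hκ, integral_inner .of_finite, integral_sub .of_finite .of_finite, integral_const,
    probReal_univ, one_smul, integral_diracPayoff_prod]
  have hx : simplexOfMeasure (simplexMeasure (sel μ)) = sel μ :=
    Subtype.ext (funext fun a => simplexMeasure_real_singleton _ a)
  rw [hx]
  exact hsel μ _

variable (hP : IsMetricProj D P) (hD : ∀ q ∈ D, WithLp.ofLp q ∈ stdSimplex ℝ (A × B))
include hP hD

theorem integral_projDist_update_sq_le {σ : Strategy (A × B) A} (hσ : IsBlackwell P σ)
    (τ : Strategy (A × B) B) (n : ℕ) (ω : ℕ → A × B) :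
    ∫ z, ((n + 2) * projDist P (n + 1) (Function.update ω (n + 1) z)) ^ 2
      ∂jointStep σ τ n (Preorder.frestrictLe (π := fun _ => A × B) n ω) ≤
      ((n + 1) * projDist P n ω) ^ 2 + 2 := by
  refine (integral_mono .of_finite .of_finite
    (projDist_update_sq_le hP hD n ω)).trans ?_
  rw [integral_add .of_finite .of_finite, integral_add .of_finite .of_finite, integral_const,
    integral_const, probReal_univ, one_smul, one_smul, integral_const_mul, integral_const_mul]
  have := mul_nonpos_of_nonneg_of_nonpos (show (0 : ℝ) ≤ n + 1 by positivity) (hσ τ n ω)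
  linarith

/-- The cross term has nonpositive conditional mean, so each round adds at most the squared diameter
`2`. -/
theorem integral_projDist_sq_le {σ : Strategy (A × B) A} (hσ : IsBlackwell P σ)
    (τ : Strategy (A × B) B) (n : ℕ) :
    ∫ ω, ((n + 1) * projDist P n ω) ^ 2 ∂play σ τ ≤ 2 * ((n : ℝ) + 1) := by
  induction n with
  | zero =>
    calc _ ≤ ∫ _, (2 : ℝ) ∂play σ τ := by
          refine integral_mono (integrable_of_dependsOn (n := 0) fun ω ω' h => ?_)
            (integrable_const _) fun ω => ?_
          · simp only [dependsOn_projDist 0 h]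
          · simpa using projDist_zero_sq_le hP hD ω
      _ ≤ _ := by simp
  | succ n ih =>
    have h := integral_play_succ_le (σ := σ) (τ := τ) (n := n)
      (Φ := fun ω => ((n + 2) * projDist P (n + 1) ω) ^ 2)
      (Ψ := fun ω => ((n + 1) * projDist P n ω) ^ 2 + 2)
      (fun ω ω' h => by simp only [dependsOn_projDist (n + 1) h])
      (fun ω ω' h => by simp only [dependsOn_projDist n h])
      (integral_projDist_update_sq_le hP hD hσ τ n)
    rw [integral_add (integrable_of_dependsOn (n := n)
      (fun ω ω' h => by simp only [dependsOn_projDist n h])) (integrable_const _),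
      integral_const, probReal_univ, one_smul] at h
    have e : ((n + 1 : ℕ) : ℝ) + 1 = n + 2 := by push_cast; ring
    rw [e]
    linarith

/-- A maximal inequality for the distance to the target set. -/
theorem measureReal_exists_projDist_ge_le {σ : Strategy (A × B) A} (hσ : IsBlackwell P σ)
    (τ : Strategy (A × B) B) (m : ℕ) {c : ℝ} (hc : 0 < c) :
    (play σ τ).real {ω | ∃ n, m ≤ n ∧ c ≤ projDist P n ω ^ 2} ≤ 4 / ((m + 1) * c) := by
  -- The squared distance increases in conditional mean by at most `2 / (n + 2)²`, which is at most
  -- `2 / (n + 1) - 2 / (n + 2)`; the compensator `2 / (n + 1)` thus yields a supermartingale. The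
  -- final `4` is `2` from the second moment plus `2` from the compensator.
  have hV : ∀ n : ℕ, DependsOn (fun ω => projDist P n ω ^ 2 + 2 / (n + 1)) (Set.Iic n) :=
    fun n ω ω' h => by simp only [dependsOn_projDist n h]
  have hmax := measureReal_exists_ge_le (σ := σ) (τ := τ) (m := m)
    (V := fun n ω => projDist P n ω ^ 2 + 2 / (n + 1)) hV (fun n ω => by positivity)
    (fun n _ ω => ?_) hc
  · have hE : ∫ ω, (projDist P m ω ^ 2 + 2 / (m + 1)) ∂play σ τ ≤ 4 / ((m : ℝ) + 1) := by
      have h := integral_projDist_sq_le hP hD hσ τ m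
      simp only [mul_pow] at h
      rw [integral_const_mul] at h
      rw [integral_add (integrable_of_dependsOn (n := m)
        (fun ω ω' h => by simp only [dependsOn_projDist m h])) (integrable_const _),
        integral_const, probReal_univ, one_smul]
      have hm : (0 : ℝ) < m + 1 := by positivity
      have : ∫ ω, projDist P m ω ^ 2 ∂play σ τ ≤ 2 / ((m : ℝ) + 1) := by
        rw [le_div_iff₀ hm]
        nlinarith
      calc _ ≤ (2 : ℝ) / (m + 1) + 2 / (m + 1) := by gcongr
        _ = 4 / (m + 1) := by ring
    refine (measureReal_mono ?_).trans (hmax.trans ?_)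
    · rintro ω ⟨n, hn, hcn⟩
      exact ⟨n, hn, hcn.trans (le_add_of_nonneg_right (by positivity))⟩
    · rw [← div_div]
      gcongr
  · have h := integral_projDist_update_sq_le hP hD hσ τ n ω
    simp only [mul_pow] at h
    rw [integral_const_mul] at h
    rw [integral_add .of_finite .of_finite, integral_const, probReal_univ, one_smul]
    set I := ∫ z, projDist P (n + 1) (Function.update ω (n + 1) z) ^ 2
      ∂jointStep σ τ n (Preorder.frestrictLe (π := fun _ => A × B) n ω)
    have hn : (0 : ℝ) < n + 1 := by positivity
    have h2 : I ≤ projDist P n ω ^ 2 + 2 / (n + 2) ^ 2 := by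
      have : I ≤ ((n + 1) ^ 2 * projDist P n ω ^ 2 + 2) / (n + 2) ^ 2 := by
        rw [le_div_iff₀ (by positivity)]
        linarith
      refine this.trans ?_
      rw [add_div]
      gcongr
      rw [div_le_iff₀ (by positivity), mul_comm]
      gcongr
      linarith
    have h3 : (2 : ℝ) / (n + 2) ^ 2 + 2 / (n + 2) ≤ 2 / (n + 1) := by
      rw [div_add_div _ _ (by positivity) (by positivity),
        div_le_div_iff₀ (by positivity) (by positivity)]
      nlinarith [mul_pos hn hn, mul_pos (mul_pos hn hn) hn]
    have e : ((n + 1 : ℕ) : ℝ) + 1 = n + 2 := by push_cast; ring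
    rw [e]
    linarith

/-- In the chord bound `cosh_le_of_sq_le`, the cross term has a nonnegative coefficient fixed by the
past and a nonpositive conditional mean. Only the factor `cosh (l √2)` is left, once per round. -/
theorem integral_cosh_projDist_le {σ : Strategy (A × B) A} (hσ : IsBlackwell P σ)
    (τ : Strategy (A × B) B) {l : ℝ} (hl : 0 ≤ l) (n : ℕ) :
    ∫ ω, Real.cosh (l * ((n + 1) * projDist P n ω)) ∂play σ τ ≤
      Real.cosh (l * √2) ^ (n + 1) := by
  induction n with
  | zero =>
    calc _ ≤ ∫ _, Real.cosh (l * √2) ∂play σ τ := by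
          refine integral_mono (integrable_of_dependsOn (n := 0) fun ω ω' h => ?_)
            (integrable_const _) fun ω => ?_
          · simp only [dependsOn_projDist 0 h]
          · have h0 := projDist_nonneg (P := P) 0 ω
            simp only [CharP.cast_eq_zero, zero_add, one_mul]
            rw [Real.cosh_le_cosh, abs_of_nonneg (by positivity), abs_of_nonneg (by positivity)]
            gcongr
            exact Real.le_sqrt_of_sq_le (projDist_zero_sq_le hP hD ω)
      _ ≤ _ := by simp
  | succ n ih =>
    have h := integral_play_succ_le (σ := σ) (τ := τ) (n := n)
      (Φ := fun ω => Real.cosh (l * ((n + 2) * projDist P (n + 1) ω)))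
      (Ψ := fun ω => Real.cosh (l * ((n + 1) * projDist P n ω)) * Real.cosh (l * √2))
      (fun ω ω' h => by simp only [dependsOn_projDist (n + 1) h])
      (fun ω ω' h => by simp only [dependsOn_projDist n h])
      (fun ω => ?_)
    · rw [integral_mul_const] at h
      have e : ((n + 1 : ℕ) : ℝ) + 1 = n + 2 := by push_cast; ring
      rw [e, pow_succ]
      exact h.trans (mul_le_mul_of_nonneg_right ih (Real.cosh_pos _).le)
    · set R := l * ((n + 1) * projDist P n ω) with hR
      set k := Real.sinh R * Real.sinh (l * √2) / (R * (l * √2))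
      have hR0 : 0 ≤ R := by
        have := projDist_nonneg (P := P) n ω
        positivity
      have hb0 : 0 ≤ l * √2 := by positivity
      have hk : 0 ≤ k := div_nonneg
        (mul_nonneg (Real.sinh_nonneg_iff.2 hR0) (Real.sinh_nonneg_iff.2 hb0))
        (mul_nonneg hR0 hb0)
      have hpt : ∀ z, Real.cosh (l * ((n + 2) *
          projDist P (n + 1) (Function.update ω (n + 1) z))) ≤
          Real.cosh R * Real.cosh (l * √2) + k * (l ^ 2 * (n + 1)) *
            ⟪empiricalPure (n + 1) ω - P (empiricalPure (n + 1) ω),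
              diracPayoff z.1 z.2 - P (empiricalPure (n + 1) ω)⟫ := by
        intro z
        have h1 := projDist_update_sq_le hP hD n ω z
        have h2 := abs_inner_le_mul_sqrt_two hP hD (μ := empiricalPure (n + 1) ω) z
        have h3 := projDist_nonneg (P := P) (n + 1) (Function.update ω (n + 1) z)
        rw [mul_assoc k]
        refine cosh_le_of_sq_le hR0 hb0 (by positivity) ?_ ?_
        · rw [abs_mul, abs_of_nonneg (by positivity)]
          calc _ ≤ l ^ 2 * (n + 1) * (‖empiricalPure (n + 1) ω - P (empiricalPure (n + 1) ω)‖
                * √2) := by gcongr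
            _ = _ := by rw [hR, projDist]; ring
        · rw [mul_pow l, hR, mul_pow l, mul_pow l √2, Real.sq_sqrt (by norm_num)]
          nlinarith [mul_le_mul_of_nonneg_left h1 (sq_nonneg l)]
      refine (integral_mono .of_finite .of_finite hpt).trans ?_
      rw [integral_add .of_finite .of_finite, integral_const, probReal_univ, one_smul,
        integral_const_mul]
      have := mul_nonpos_of_nonneg_of_nonpos
        (show (0 : ℝ) ≤ k * (l ^ 2 * (n + 1)) by positivity) (hσ τ n ω)
      linarith

/-- A Gaussian tail for the distance to the target set. -/
theorem measureReal_projDist_ge_le {σ : Strategy (A × B) A} (hσ : IsBlackwell P σ)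
    (τ : Strategy (A × B) B) (n : ℕ) {L : ℝ} (hL : 0 ≤ L) :
    (play σ τ).real {ω | 2 * √(L * (n + 1)) ≤ (n + 1) * projDist P n ω} ≤ 2 * Real.exp (-L) := by
  have hn : (0 : ℝ) < n + 1 := by positivity
  -- This `l` minimizes `l² (n + 1) - l r` for the threshold `r = 2 √(L (n + 1))`: the moment is at
  -- most `exp L`, while at the threshold `cosh (2 L) ≥ exp (2 L) / 2`.
  set l := √(L / (n + 1)) with hl
  have hl0 : 0 ≤ l := Real.sqrt_nonneg _
  have hlL : l ^ 2 * (n + 1) = L := by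
    rw [hl, Real.sq_sqrt (by positivity), div_mul_cancel₀ _ hn.ne']
  have hll : l * √(L * (n + 1)) = L := by
    rw [hl, ← Real.sqrt_mul (by positivity)]
    have : L / (n + 1) * (L * (n + 1)) = L ^ 2 := by field_simp
    rw [this, Real.sqrt_sq hL]
  have hint : Integrable (fun ω => Real.cosh (l * ((n + 1) * projDist P n ω))) (play σ τ) :=
    integrable_of_dependsOn (n := n) fun ω ω' h => by simp only [dependsOn_projDist n h]
  have hmarkov := mul_meas_ge_le_integral_of_nonneg (μ := play σ τ)
    (Filter.Eventually.of_forall fun ω => (Real.cosh_pos _).le) hint (Real.exp (2 * L) / 2)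
  have hmom : ∫ ω, Real.cosh (l * ((n + 1) * projDist P n ω)) ∂play σ τ ≤ Real.exp L := by
    refine (integral_cosh_projDist_le hP hD hσ τ hl0 n).trans ?_
    calc Real.cosh (l * √2) ^ (n + 1) ≤ Real.exp ((l * √2) ^ 2 / 2) ^ (n + 1) :=
          pow_le_pow_left₀ (Real.cosh_pos _).le (Real.cosh_le_exp_half_sq _) _
      _ = Real.exp L := by
          rw [← Real.exp_nat_mul, mul_pow, Real.sq_sqrt (show (0 : ℝ) ≤ 2 by norm_num)]
          congr 1
          push_cast
          linear_combination hlL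
  have hsub : (play σ τ).real {ω | 2 * √(L * (n + 1)) ≤ (n + 1) * projDist P n ω} ≤
      (play σ τ).real {ω | Real.exp (2 * L) / 2 ≤
        Real.cosh (l * ((n + 1) * projDist P n ω))} := by
    refine measureReal_mono fun ω hω => ?_
    have h1 : 2 * L ≤ l * ((n + 1) * projDist P n ω) := by
      calc 2 * L = l * (2 * √(L * (n + 1))) := by rw [← mul_assoc, mul_comm l 2, mul_assoc, hll]
        _ ≤ _ := mul_le_mul_of_nonneg_left hω hl0
    change _ ≤ Real.cosh _
    rw [Real.cosh_eq]
    have := Real.exp_pos (-(l * ((n + 1) * projDist P n ω)))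
    have := Real.exp_le_exp.2 h1
    linarith
  refine hsub.trans ?_
  have h := hmarkov.trans hmom
  have h5 : Real.exp (2 * L) = Real.exp L * Real.exp L := by rw [← Real.exp_add]; ring_nf
  have h6 : Real.exp L * Real.exp (-L) = 1 := by rw [← Real.exp_add]; simp
  have hpos := Real.exp_pos L
  rw [h5] at h ⊢
  refine le_of_mul_le_mul_left ?_ (mul_pos hpos hpos)
  nlinarith

end Blackwell

/-! ### Measurable deterministic strategies with mixed actions. -/

section Measurability

theorem measurable_extendHistory {Z : Type*} [Nonempty Z] [MeasurableSpace Z] (n : ℕ) :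
    Measurable (extendHistory (Z := Z) n) := by
  refine measurable_pi_lambda _ fun t => ?_
  by_cases ht : t ∈ Finset.Iic n
  · simp only [extendHistory, dif_pos ht]
    fun_prop
  · simp only [extendHistory, dif_neg ht]
    fun_prop

theorem measurable_averagePayoff {X Y V : Type*} [MeasurableSpace X] [MeasurableSpace Y]
    [NormedAddCommGroup V] [NormedSpace ℝ V] [MeasurableSpace V] [BorelSpace V]
    [SecondCountableTopology V] {g : X → Y → V} (hg : Measurable fun z : X × Y => g z.1 z.2)
    (T : ℕ) : Measurable (averagePayoff g T) := by
  have h : ∀ t : ℕ, Measurable fun ω : ℕ → X × Y => g (ω t).1 (ω t).2 := fun t =>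
    hg.comp (measurable_pi_apply t)
  exact (Finset.measurable_fun_sum _ fun t _ => h t).const_smul _

variable {A B : Type*} [Fintype A] [Fintype B]

theorem continuous_prodDist :
    Continuous fun z : stdSimplex ℝ A × stdSimplex ℝ B => prodDist z.1 z.2 := by
  refine (PiLp.continuous_toLp 2 _).comp (continuous_pi fun p => ?_)
  exact ((continuous_apply p.1).comp (continuous_subtype_val.comp continuous_fst)).mul
    ((continuous_apply p.2).comp (continuous_subtype_val.comp continuous_snd))

end Measurability

section Deterministic

variable {X Y : Type*} [MeasurableSpace X] [MeasurableSpace Y]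

/-- The strategy that chooses its actions as measurable functions of the past. -/
def deterministicStrategy (x₀ : X) (f : (n : ℕ) → ((i : Finset.Iic n) → X × Y) → X)
    (hf : ∀ n, Measurable (f n)) : Strategy (X × Y) X where
  init := Measure.dirac x₀
  step n := Kernel.deterministic (f n) (hf n)
  isProbabilityMeasure_init := inferInstance
  isMarkovKernel_step _ := inferInstance

theorem isDeterministic_deterministicStrategy (x₀ : X)
    (f : (n : ℕ) → ((i : Finset.Iic n) → X × Y) → X) (hf : ∀ n, Measurable (f n)) :
    (deterministicStrategy x₀ f hf).IsDeterministic :=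
  ⟨⟨x₀, rfl⟩, fun n => ⟨f n, hf n, rfl⟩⟩

theorem ae_play_deterministicStrategy [MeasurableEq X] (x₀ : X)
    (f : (n : ℕ) → ((i : Finset.Iic n) → X × Y) → X) (hf : ∀ n, Measurable (f n))
    (τ : Strategy (X × Y) Y) :
    ∀ᵐ ω ∂play (deterministicStrategy x₀ f hf) τ, ∀ n,
      (ω (n + 1)).1 = f n (Preorder.frestrictLe (π := fun _ => X × Y) n ω) := by
  refine ae_all_iff.2 fun n => ?_
  refine ae_play_succ (p := fun z => z.2.1 = f n z.1)
    (measurableSet_eq_fun (by fun_prop) ((hf n).comp measurable_fst)) fun h => ?_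
  rw [jointStep, Kernel.prod_apply]
  refine Measure.quasiMeasurePreserving_fst.ae (p := fun x => x = f n h) ?_
  have e : (deterministicStrategy x₀ f hf).step n h = Measure.dirac (f n h) :=
    Kernel.deterministic_apply (hf n) h
  rw [e]
  exact (ae_dirac_iff (measurableSet_eq_fun measurable_id measurable_const)).2 rfl

end Deterministic

/-! ### Blackwell's strategy with mixed actions: a pathwise bound. -/

section MixedBlackwell

variable {A B : Type*} [Fintype A] [Fintype B] [Nonempty A] [Nonempty B]
    {D : Set (EuclideanSpace ℝ (A × B))}
    {P : EuclideanSpace ℝ (A × B) → EuclideanSpace ℝ (A × B)}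

/-- The slack `η` turns the half-space condition into strict inequalities, open in the action, so
some term of a dense sequence satisfies them. Taking the first such term is measurable in `μ`
because `P` is continuous. -/
theorem exists_measurable_selection (hP : IsMetricProj D P)
    (hD : ∀ y : stdSimplex ℝ B, ∃ x : stdSimplex ℝ A, prodDist x y ∈ D) {η : ℝ} (hη : 0 < η) :
    ∃ sel : EuclideanSpace ℝ (A × B) → stdSimplex ℝ A, Measurable sel ∧
      ∀ μ (y : stdSimplex ℝ B), ⟪μ - P μ, prodDist (sel μ) y - P μ⟫ ≤ η := by
  classical
  let x : ℕ → stdSimplex ℝ A := TopologicalSpace.denseSeq _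
  let p : EuclideanSpace ℝ (A × B) → ℕ → Prop := fun μ k =>
    ∀ b, ∑ a, (x k : A → ℝ) a * (μ - P μ) (a, b) < ⟪μ - P μ, P μ⟫ + η
  have hPc := hP.lipschitzWith.continuous
  have hex : ∀ μ, ∃ k, p μ k := by
    intro μ
    obtain ⟨x', hx'⟩ := exists_forall_sum_le hD (μ - P μ) (c := ⟪μ - P μ, P μ⟫) fun q hq => by
      have := hP.inner_le μ q hq
      rw [inner_sub_right] at this
      linarith
    have hopen : IsOpen {x : stdSimplex ℝ A |
        ∀ b, ∑ a, (x : A → ℝ) a * (μ - P μ) (a, b) < ⟪μ - P μ, P μ⟫ + η} := by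
      simp only [Set.ofPred_forall]
      refine isOpen_iInter_of_finite fun b => isOpen_lt ?_ continuous_const
      exact continuous_finsetSum _ fun a _ =>
        ((continuous_apply a).comp continuous_subtype_val).mul continuous_const
    obtain ⟨k, hk⟩ := (TopologicalSpace.denseRange_denseSeq (stdSimplex ℝ A)).exists_mem_open
      hopen ⟨x', fun b => (hx' b).trans_lt (by linarith)⟩
    exact ⟨k, hk⟩
  have hmeas : ∀ k, MeasurableSet {μ | p μ k} := by
    intro k
    simp only [p, Set.ofPred_forall]
    refine MeasurableSet.iInter fun b => (isOpen_lt ?_ ?_).measurableSet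
    · refine continuous_finsetSum _ fun a _ => continuous_const.mul ?_
      exact (EuclideanSpace.proj (𝕜 := ℝ) (a, b)).continuous.comp (continuous_id.sub hPc)
    · exact ((continuous_id.sub hPc).inner hPc).add continuous_const
  refine ⟨fun μ => x (Nat.find (hex μ)),
    (measurable_from_nat (f := x)).comp (measurable_find hex hmeas), fun μ y => ?_⟩
  have := inner_prodDist_le (fun b => (Nat.find_spec (hex μ) b).le) y
  rw [inner_sub_right]
  linarith

theorem exists_isDeterministic_norm_le (hP : IsMetricProj D P)
    (hD : ∀ q ∈ D, WithLp.ofLp q ∈ stdSimplex ℝ (A × B))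
    (hRAC : ∀ y : stdSimplex ℝ B, ∃ x : stdSimplex ℝ A, prodDist x y ∈ D) :
    ∃ σ : Strategy (stdSimplex ℝ A × stdSimplex ℝ B) (stdSimplex ℝ A), σ.IsDeterministic ∧
      ∀ τ : Strategy (stdSimplex ℝ A × stdSimplex ℝ B) (stdSimplex ℝ B),
        ∀ᵐ ω ∂play σ τ, ∀ T : ℕ, 1 ≤ T →
          ‖empiricalMixed T ω - P (empiricalMixed T ω)‖ ≤ 2 / √(T : ℝ) := by
  -- The inner product is multiplied by the number `n + 1` of past rounds, so a slack `1 / (n + 1)`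
  -- costs at most `1`.
  choose sel hsel hsel_le using fun n : ℕ =>
    exists_measurable_selection hP hRAC (η := 1 / ((n : ℝ) + 1)) (by positivity)
  let f : (n : ℕ) → ((i : Finset.Iic n) → stdSimplex ℝ A × stdSimplex ℝ B) → stdSimplex ℝ A :=
    fun n h => sel n (empiricalMixed (n + 1) (extendHistory n h))
  have hf : ∀ n, Measurable (f n) := fun n =>
    (hsel n).comp ((measurable_averagePayoff continuous_prodDist.measurable (n + 1)).comp
      (measurable_extendHistory n))
  refine ⟨deterministicStrategy (Classical.arbitrary _) f hf,
    isDeterministic_deterministicStrategy _ f hf, fun τ => ?_⟩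
  filter_upwards [ae_play_deterministicStrategy (Classical.arbitrary _) f hf τ] with ω hω T hT
  -- Each round adds `2` for the squared diameter and at most `2 * 1` for the slack. In the first
  -- round the cross term is multiplied by `0`, so the initial action may be arbitrary.
  have key : ∀ T : ℕ, (T * ‖empiricalMixed T ω - P (empiricalMixed T ω)‖) ^ 2 ≤ 4 * (T : ℝ) := by
    intro T
    induction T with
    | zero => simp
    | succ T ih =>
      have h := hP.sq_le_step (succ_smul_averagePayoff (g := prodDist) T ω)
        (norm_sub_sq_le_two (prodDist_mem_stdSimplex _ _) (hD _ (hP.mem _)))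
      have h2 : T * ⟪empiricalMixed T ω - P (empiricalMixed T ω),
          prodDist (ω T).1 (ω T).2 - P (empiricalMixed T ω)⟫ ≤ 1 := by
        rcases T with _ | n
        · simp
        · have hμ : empiricalMixed (n + 1) (extendHistory n (Preorder.frestrictLe
              (π := fun _ => stdSimplex ℝ A × stdSimplex ℝ B) n ω)) =
                empiricalMixed (n + 1) ω :=
            (eq_extendHistory_of_dependsOn (dependsOn_averagePayoff (g := prodDist) n) ω).symm
          have h3 := hsel_le n (empiricalMixed (n + 1) ω) (ω (n + 1)).2
          have h4 : (ω (n + 1)).1 = sel n (empiricalMixed (n + 1) ω) := by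
            rw [hω n, ← hμ]
          rw [← h4, le_div_iff₀ (by positivity)] at h3
          push_cast
          linarith
      push_cast
      refine h.trans ?_
      change (T * ‖empiricalMixed T ω - P (empiricalMixed T ω)‖) ^ 2 + 2 * _ + 2 ≤ _
      have h5 := mul_le_mul_of_nonneg_left h2 (zero_le_two (α := ℝ))
      exact (add_le_add (add_le_add ih h5) le_rfl).trans (by linarith)
  have hT0 : (0 : ℝ) < T := by exact_mod_cast hT
  rw [le_div_iff₀ (Real.sqrt_pos.2 hT0)]
  refine le_of_sq_le_sq ?_ zero_le_two
  have hk := key T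
  rw [mul_pow, Real.sq_sqrt hT0.le]
  rw [mul_pow] at hk
  have : (T : ℝ) * (‖empiricalMixed T ω - P (empiricalMixed T ω)‖ ^ 2 * T) ≤ T * 2 ^ 2 := by
    linarith
  exact le_of_mul_le_mul_left this hT0

end MixedBlackwell

/-! ### Necessity of (RAC): an opponent who draws independently. -/

theorem convexOn_infDist {V : Type*} [NormedAddCommGroup V] [NormedSpace ℝ V] [ProperSpace V]
    {C : Set V} (hne : C.Nonempty) (hcl : IsClosed C) (hconv : Convex ℝ C) :
    ConvexOn ℝ Set.univ fun v => Metric.infDist v C := by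
  refine ⟨convex_univ, fun v _ w _ a b ha hb hab => ?_⟩
  obtain ⟨p, hp, hvp⟩ := hcl.exists_infDist_eq_dist hne v
  obtain ⟨q, hq, hwq⟩ := hcl.exists_infDist_eq_dist hne w
  refine (Metric.infDist_le_dist_of_mem (hconv hp hq ha hb hab)).trans ?_
  simp only [hvp, hwq, dist_eq_norm]
  calc ‖a • v + b • w - (a • p + b • q)‖ = ‖a • (v - p) + b • (w - q)‖ := by
        congr 1
        rw [smul_sub, smul_sub]
        abel
    _ ≤ ‖a • (v - p)‖ + ‖b • (w - q)‖ := norm_add_le _ _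
    _ = a • ‖v - p‖ + b • ‖w - q‖ := by
        rw [norm_smul, norm_smul, Real.norm_of_nonneg ha, Real.norm_of_nonneg hb, smul_eq_mul,
          smul_eq_mul]

section IID

variable {X Y : Type*} [MeasurableSpace X] [MeasurableSpace Y]

/-- The strategy that draws all actions independently according to `κ`. -/
def iidStrategy {Z U : Type*} [MeasurableSpace Z] [MeasurableSpace U] (κ : Measure U)
    [IsProbabilityMeasure κ] : Strategy Z U where
  init := κ
  step _ := Kernel.const _ κ
  isProbabilityMeasure_init := inferInstance
  isMarkovKernel_step _ := inferInstance

/-- Conditionally on the past the pair has a product law whose second factor is always `κ`, so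
averaging over histories only mixes the first factor. -/
theorem exists_map_play_iidStrategy (σ : Strategy (X × Y) X) (κ : Measure Y)
    [IsProbabilityMeasure κ] (t : ℕ) :
    ∃ α : Measure X, IsProbabilityMeasure α ∧
      (play σ (iidStrategy κ)).map (fun ω => ω t) = α.prod κ := by
  rcases t with _ | n
  · exact ⟨σ.init, inferInstance, map_zero_play σ _⟩
  · set Q := (play σ (iidStrategy κ)).map (Preorder.frestrictLe (π := fun _ => X × Y) n)
    have hQ : IsProbabilityMeasure Q := Measure.isProbabilityMeasure_map (by fun_prop)
    refine ⟨Q.bind (σ.step n), inferInstance, ?_⟩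
    rw [map_succ_play]
    refine (Measure.prod_eq fun s u hs hu => ?_).symm
    rw [Measure.bind_apply (hs.prod hu) (Kernel.aemeasurable _),
      Measure.bind_apply hs (Kernel.aemeasurable _),
      ← lintegral_mul_const _ (Kernel.measurable_coe _ hs)]
    refine lintegral_congr fun h => ?_
    rw [jointStep, Kernel.prod_apply, Measure.prod_prod]
    rfl

end IID

section Necessity

variable {A B : Type*} [Fintype A] [Fintype B]

/-- For fixed `y`, `x ⊗ y` is affine in `x`. Averages over rounds therefore keep this form, as do
integrals once the range is known to be closed. -/
theorem convex_range_prodDist (y : stdSimplex ℝ B) :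
    Convex ℝ (Set.range fun x : stdSimplex ℝ A => prodDist x y) := by
  rintro _ ⟨x, rfl⟩ _ ⟨x', rfl⟩ a b ha hb hab
  refine ⟨⟨_, convex_stdSimplex ℝ A x.2 x'.2 ha hb hab⟩, ?_⟩
  ext p
  change (a * (x : A → ℝ) p.1 + b * (x' : A → ℝ) p.1) * (y : B → ℝ) p.2 =
    a * ((x : A → ℝ) p.1 * (y : B → ℝ) p.2) + b * ((x' : A → ℝ) p.1 * (y : B → ℝ) p.2)
  ring

theorem isClosed_range_prodDist (y : stdSimplex ℝ B) :
    IsClosed (Set.range fun x : stdSimplex ℝ A => prodDist x y) :=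
  (isCompact_range (continuous_prodDist.comp (by fun_prop : Continuous fun x => (x, y)))).isClosed

variable {X Y : Type*} [MeasurableSpace X] [MeasurableSpace Y]
  {d : ℕ} {mbar : A → B → Set (EuclideanSpace ℝ (Fin d))} {M : ℝ}
  {C : Set (EuclideanSpace ℝ (Fin d))} {g : X → Y → EuclideanSpace ℝ (A × B)}

theorem exists_integral_averagePayoff_eq (hg : Measurable fun z : X × Y => g z.1 z.2)
    (hgs : ∀ x y, WithLp.ofLp (g x y) ∈ stdSimplex ℝ (A × B)) (σ : Strategy (X × Y) X)
    {y : stdSimplex ℝ B} {κ : Measure Y} [IsProbabilityMeasure κ]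
    (hκ : ∀ α : Measure X, IsProbabilityMeasure α →
      ∃ x : stdSimplex ℝ A, ∫ z, g z.1 z.2 ∂α.prod κ = prodDist x y) (n : ℕ) :
    ∃ x : stdSimplex ℝ A,
      ∫ ω, averagePayoff g (n + 1) ω ∂play σ (iidStrategy κ) = prodDist x y := by
  have hx : ∀ t : ℕ, ∃ x : stdSimplex ℝ A,
      ∫ ω, g (ω t).1 (ω t).2 ∂play σ (iidStrategy κ) = prodDist x y := by
    intro t
    obtain ⟨α, hα, hmap⟩ := exists_map_play_iidStrategy σ κ t
    obtain ⟨x, hx⟩ := hκ α hα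
    refine ⟨x, ?_⟩
    rw [← hx, ← hmap, integral_map (measurable_pi_apply t).aemeasurable hg.aestronglyMeasurable]
  have hint : ∀ t : ℕ, Integrable (fun ω => g (ω t).1 (ω t).2) (play σ (iidStrategy κ)) := by
    intro t
    refine Integrable.of_bound (hg.comp (measurable_pi_apply t)).aestronglyMeasurable 1
      (Filter.Eventually.of_forall fun ω => ?_)
    exact (sq_le_one_iff₀ (norm_nonneg _)).1 (norm_sq_le_one_of_mem_stdSimplex (hgs _ _))
  choose x hx using hx
  have hmem : ((n + 1 : ℕ) : ℝ)⁻¹ • ∑ t ∈ Finset.range (n + 1), prodDist (x t) y ∈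
      Set.range fun x : stdSimplex ℝ A => prodDist x y := by
    rw [Finset.smul_sum]
    refine (convex_range_prodDist y).sum_mem (fun _ _ => by positivity) ?_ fun t _ => ⟨x t, rfl⟩
    rw [Finset.sum_const, Finset.card_range, nsmul_eq_mul, mul_inv_cancel₀ (by positivity)]
  obtain ⟨x', hx'⟩ := hmem
  refine ⟨x', ?_⟩
  simp only [averagePayoff]
  rw [integral_smul, integral_finsetSum _ fun t _ => hint t]
  simp only [hx]
  exact hx'.symm

/-- By Jensen, the distance at the mean `x ⊗ y` is at most the mean distance, which is bounded by
`ε` on an event of probability at least `1 - ε` and by `K = M + dist(0, C)` elsewhere. The action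
`x` comes from the play alone, hence serves all selections. -/
theorem exists_infDist_linExt_le (hbound : ∀ a b, ∀ s ∈ mbar a b, ‖s‖ ≤ M)
    (hC_ne : C.Nonempty) (hC_closed : IsClosed C) (hC_convex : Convex ℝ C)
    (hg : Measurable fun z : X × Y => g z.1 z.2)
    (hgs : ∀ x y, WithLp.ofLp (g x y) ∈ stdSimplex ℝ (A × B)) {σ : Strategy (X × Y) X}
    (hσ : DrivesToZero (fun T ω => excess (setExt mbar (averagePayoff g T ω)) C) σ)
    {y : stdSimplex ℝ B} {κ : Measure Y} [IsProbabilityMeasure κ]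
    (hκ : ∀ α : Measure X, IsProbabilityMeasure α →
      ∃ x : stdSimplex ℝ A, ∫ z, g z.1 z.2 ∂α.prod κ = prodDist x y) {ε : ℝ} (hε : 0 < ε) :
    ∃ x : stdSimplex ℝ A, ∀ s : A → B → EuclideanSpace ℝ (Fin d), (∀ a b, s a b ∈ mbar a b) →
      Metric.infDist (linExt s (prodDist x y)) C ≤ ε * (1 + (M + Metric.infDist 0 C)) := by
  obtain ⟨n, hn⟩ := hσ ε hε
  -- Using `n + 1` rounds keeps the number of rounds positive, so that the average is a probability
  -- vector.
  obtain ⟨x, hx⟩ := exists_integral_averagePayoff_eq hg hgs σ hκ n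
  refine ⟨x, fun s hs => ?_⟩
  set μ := play σ (iidStrategy κ)
  set ρ : (ℕ → X × Y) → EuclideanSpace ℝ (A × B) := averagePayoff g (n + 1)
  set K := M + Metric.infDist 0 C
  set φ : EuclideanSpace ℝ (A × B) → ℝ := fun ν => Metric.infDist (linExt s ν) C
  have hρm : Measurable ρ := measurable_averagePayoff hg (n + 1)
  have hρs : ∀ ω, WithLp.ofLp (ρ ω) ∈ stdSimplex ℝ (A × B) := averagePayoff_mem_convex
    ((convex_stdSimplex ℝ (A × B)).linear_preimage
      (WithLp.linearEquiv 2 ℝ (A × B → ℝ)).toLinearMap) hgs n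
  have hφc : Continuous φ := (Metric.continuous_infDist_pt C).comp (continuous_linExt s)
  have hφconv : ConvexOn ℝ Set.univ φ :=
    (convexOn_infDist hC_ne hC_closed hC_convex).comp_linearMap (linExt s)
  have hφ0 : ∀ ν, 0 ≤ φ ν := fun ν => Metric.infDist_nonneg
  have hφK : ∀ ω, φ (ρ ω) ≤ K := by
    intro ω
    have h1 := norm_linExt_le_sum (fun a b => hbound a b _ (hs a b)) (ρ ω)
    have h2 : ∑ p, |ρ ω p| = 1 := by
      rw [← (hρs ω).2]
      exact Finset.sum_congr rfl fun p _ => abs_of_nonneg ((hρs ω).1 p)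
    rw [h2, mul_one] at h1
    have h3 := Metric.infDist_le_infDist_add_dist (s := C) (x := linExt s (ρ ω)) (y := 0)
    rw [dist_zero_right] at h3
    change Metric.infDist (linExt s (ρ ω)) C ≤ M + Metric.infDist 0 C
    linarith
  have hK : 0 ≤ K := by
    obtain ⟨ω⟩ := nonempty_of_isProbabilityMeasure μ
    exact (hφ0 _).trans (hφK ω)
  have hφi : Integrable (φ ∘ ρ) μ := by
    refine Integrable.of_bound (hφc.measurable.comp hρm).aestronglyMeasurable K
      (Filter.Eventually.of_forall fun ω => ?_)
    rw [Function.comp_apply, Real.norm_of_nonneg (hφ0 _)]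
    exact hφK ω
  have hρi : Integrable ρ μ :=
    Integrable.of_bound hρm.aestronglyMeasurable 1 (Filter.Eventually.of_forall fun ω =>
      (sq_le_one_iff₀ (norm_nonneg _)).1 (norm_sq_le_one_of_mem_stdSimplex (hρs ω)))
  have hjensen := hφconv.map_integral_le hφc.continuousOn isClosed_univ
    (Filter.Eventually.of_forall fun _ => Set.mem_univ _) hρi hφi
  rw [hx] at hjensen
  let F : Set (ℕ → X × Y) := {ω | φ (ρ ω) ≤ ε}
  have hFm : MeasurableSet F := measurableSet_le (hφc.measurable.comp hρm) measurable_const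
  have hF : 1 - ε ≤ μ.real F := by
    rw [← ENNReal.ofReal_le_ofReal_iff measureReal_nonneg, ofReal_measureReal]
    refine (hn (iidStrategy κ)).trans (measure_mono fun ω hω => ?_)
    have h := excess_setExt_le_iff.1 (hω (n + 1) (Nat.le_succ n)) s hs
    exact ENNReal.toReal_le_of_le_ofReal hε.le h
  have hFc : μ.real Fᶜ ≤ ε := by
    rw [probReal_compl_eq_one_sub hFm]
    linarith
  have hpt : ∀ ω, φ (ρ ω) ≤ ε + Fᶜ.indicator (fun _ => K) ω := by
    intro ω
    by_cases h : ω ∈ F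
    · rw [Set.indicator_of_notMem (Set.notMem_compl_iff.2 h), add_zero]
      exact h
    · rw [Set.indicator_of_mem (Set.mem_compl h)]
      exact (hφK ω).trans (le_add_of_nonneg_left hε.le)
  have hint : Integrable (Fᶜ.indicator fun _ => K) μ :=
    (integrable_const K).indicator hFm.compl
  calc φ (prodDist x y) ≤ ∫ ω, φ (ρ ω) ∂μ := hjensen
    _ ≤ ∫ ω, (ε + Fᶜ.indicator (fun _ => K) ω) ∂μ :=
      integral_mono hφi ((integrable_const ε).add hint) hpt
    _ = ε + μ.real Fᶜ * K := by
      rw [integral_add (integrable_const ε) hint, integral_const, probReal_univ, one_smul,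
        integral_indicator_const _ hFm.compl, smul_eq_mul]
    _ ≤ ε + ε * K := by gcongr
    _ = ε * (1 + K) := by ring

theorem RAC_of_drivesToZero [Nonempty A] (hbound : ∀ a b, ∀ s ∈ mbar a b, ‖s‖ ≤ M)
    (hC_closed : IsClosed C) (hC_convex : Convex ℝ C)
    (hg : Measurable fun z : X × Y => g z.1 z.2)
    (hgs : ∀ x y, WithLp.ofLp (g x y) ∈ stdSimplex ℝ (A × B)) {σ : Strategy (X × Y) X}
    (hσ : DrivesToZero (fun T ω => excess (setExt mbar (averagePayoff g T ω)) C) σ)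
    (hκ : ∀ y : stdSimplex ℝ B, ∃ κ : Measure Y, IsProbabilityMeasure κ ∧
      ∀ α : Measure X, IsProbabilityMeasure α →
        ∃ x : stdSimplex ℝ A, ∫ z, g z.1 z.2 ∂α.prod κ = prodDist x y) :
    RAC mbar C := by
  intro y
  obtain ⟨κ, hκp, hκ⟩ := hκ y
  -- Without a selection every `setExt mbar μ` is empty and any `x` works. With one, `C` cannot be
  -- empty, since the excess would always be `∞`.
  by_cases hsel : ∃ s : A → B → EuclideanSpace ℝ (Fin d), ∀ a b, s a b ∈ mbar a b
  swap
  · exact ⟨Classical.arbitrary _, setExt_subset_iff.2 fun s hs => absurd ⟨s, hs⟩ hsel⟩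
  have hne : C.Nonempty := by
    obtain ⟨s, hs⟩ := hsel
    obtain ⟨n, hn⟩ := hσ (1 / 2) (by norm_num)
    have hpos := (ENNReal.ofReal_pos.2 (by norm_num : (0 : ℝ) < 1 - 1 / 2)).trans_le
      (hn (iidStrategy κ))
    obtain ⟨ω, hω⟩ := nonempty_of_measure_ne_zero hpos.ne'
    by_contra hC
    rw [Set.not_nonempty_iff_eq_empty] at hC
    have h := excess_setExt_le_iff.1 (hω n le_rfl) s hs
    rw [hC, Metric.infEDist_empty, top_le_iff] at h
    exact ENNReal.ofReal_ne_top h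
  choose x hx using fun n : ℕ => exists_infDist_linExt_le (mbar := mbar) (y := y) hbound hne
    hC_closed hC_convex hg hgs hσ hκ (ε := 1 / ((n : ℝ) + 1)) (by positivity)
  -- The limit is taken before any selection is fixed, so one `x'` works for all of them.
  obtain ⟨x', ψ, hψ, hlim⟩ := CompactSpace.tendsto_subseq x
  refine ⟨x', setExt_subset_iff.2 fun s hs => ?_⟩
  rw [hC_closed.mem_iff_infDist_zero hne]
  refine le_antisymm ?_ Metric.infDist_nonneg
  have hcont : Continuous fun x : stdSimplex ℝ A => Metric.infDist (linExt s (prodDist x y)) C :=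
    (Metric.continuous_infDist_pt C).comp ((continuous_linExt s).comp
      (continuous_prodDist.comp (by fun_prop : Continuous fun x => (x, y))))
  have h1 := (tendsto_one_div_add_atTop_nhds_zero_nat (𝕜 := ℝ)).mul_const
    (1 + (M + Metric.infDist 0 C))
  rw [zero_mul] at h1
  exact le_of_tendsto_of_tendsto' ((hcont.tendsto x').comp hlim) (h1.comp hψ.tendsto_atTop)
    fun n => hx (ψ n) s hs

end Necessity

section Settings

variable {A B : Type*} [Fintype A] [Fintype B] [Nonempty A] {d : ℕ}
  {mbar : A → B → Set (EuclideanSpace ℝ (Fin d))} {M : ℝ}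
  {C : Set (EuclideanSpace ℝ (Fin d))}

theorem RobustApproachesPure.rac [DecidableEq A] [DecidableEq B] [MeasurableSpace A]
    [MeasurableSpace B] [DiscreteMeasurableSpace A] [DiscreteMeasurableSpace B]
    (hbound : ∀ a b, ∀ s ∈ mbar a b, ‖s‖ ≤ M)
    (hC_closed : IsClosed C) (hC_convex : Convex ℝ C) {σ : Strategy (A × B) A}
    (hσ : RobustApproachesPure mbar C σ) : RAC mbar C := by
  refine RAC_of_drivesToZero (g := diracPayoff) hbound hC_closed hC_convex .of_discrete
    diracPayoff_mem_stdSimplex hσ ?_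
  intro y
  -- With pure actions the opponent draws `b` with probability `y b`; with mixed actions, it plays
  -- `y` itself at every round.
  refine ⟨simplexMeasure y, inferInstance, fun α hα => ⟨simplexOfMeasure α, ?_⟩⟩
  rw [integral_diracPayoff_prod]
  congr 1
  exact Subtype.ext (funext fun b => simplexMeasure_real_singleton _ b)

theorem RobustApproachesMixed.rac (hbound : ∀ a b, ∀ s ∈ mbar a b, ‖s‖ ≤ M)
    (hC_closed : IsClosed C) (hC_convex : Convex ℝ C)
    {σ : Strategy (stdSimplex ℝ A × stdSimplex ℝ B) (stdSimplex ℝ A)}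
    (hσ : RobustApproachesMixed mbar C σ) : RAC mbar C := by
  refine RAC_of_drivesToZero (g := prodDist) hbound hC_closed hC_convex
    continuous_prodDist.measurable prodDist_mem_stdSimplex hσ ?_
  intro y
  refine ⟨Measure.dirac y, inferInstance, fun α hα => ?_⟩
  have hc : Continuous fun x : stdSimplex ℝ A => prodDist x y :=
    continuous_prodDist.comp (by fun_prop : Continuous fun x => (x, y))
  rw [Measure.prod_dirac, integral_map (by fun_prop)
    continuous_prodDist.measurable.aestronglyMeasurable]
  obtain ⟨x, hx⟩ := (convex_range_prodDist y).integral_mem (μ := α) (isClosed_range_prodDist y)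
    (Filter.Eventually.of_forall fun x => Set.mem_range_self x)
    (Integrable.of_bound hc.measurable.aestronglyMeasurable 1
      (Filter.Eventually.of_forall fun x => (sq_le_one_iff₀ (norm_nonneg _)).1
        (norm_sq_le_one_of_mem_stdSimplex (prodDist_mem_stdSimplex x y))))
  exact ⟨x, hx.symm⟩

end Settings

theorem ofReal_one_sub_le_measure {Ω : Type*} [MeasurableSpace Ω] {μ : Measure Ω}
    [IsProbabilityMeasure μ] {s t : Set Ω} {δ : ℝ} (hδ : 0 ≤ δ) (hst : ∀ ω, ω ∉ t → ω ∈ s)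
    (ht : μ.real t ≤ δ) : ENNReal.ofReal (1 - δ) ≤ μ s := by
  rw [ENNReal.ofReal_sub _ hδ, ENNReal.ofReal_one, tsub_le_iff_right]
  calc 1 = μ Set.univ := measure_univ.symm
    _ ≤ μ (s ∪ t) := measure_mono fun ω _ => (em (ω ∈ t)).elim Or.inr fun h => Or.inl (hst ω h)
    _ ≤ μ s + μ t := measure_union_le _ _
    _ ≤ μ s + ENNReal.ofReal δ := by
        gcongr
        rw [← ofReal_measureReal]
        exact ENNReal.ofReal_le_ofReal ht

/-! ### From (RAC) to approachability of the lifted set, with rates. -/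

section Rates

variable {A B : Type*} [Fintype A] [Fintype B] [Nonempty B]
  {d : ℕ} {mbar : A → B → Set (EuclideanSpace ℝ (Fin d))} {M : ℝ}
  {C : Set (EuclideanSpace ℝ (Fin d))}

theorem RAC.exists_isMetricProj (h : RAC mbar C) (hC_closed : IsClosed C)
    (hC_convex : Convex ℝ C) : ∃ P, IsMetricProj (liftedSet mbar C) P :=
  let ⟨_, hx⟩ := h.exists_prodDist_mem (Classical.arbitrary _)
  RobustApproachability.exists_isMetricProj ⟨_, hx⟩ (isClosed_liftedSet hC_closed)
    (convex_liftedSet hC_convex)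

variable [Nonempty A]

theorem excess_setExt_le_ofReal (hM : 0 < M) (hbound : ∀ a b, ∀ s ∈ mbar a b, ‖s‖ ≤ M)
    {μ : EuclideanSpace ℝ (A × B)} {β : ℝ}
    (h : Metric.infEDist μ (liftedSet mbar C) ≤ ENNReal.ofReal β) :
    excess (setExt mbar μ) C ≤
      ENNReal.ofReal (M * √((Fintype.card A : ℝ) * Fintype.card B) * β) := by
  rw [ENNReal.ofReal_mul (by positivity)]
  exact (excess_setExt_le hM hbound μ).trans (by gcongr)

theorem RAC.exists_mixed_rate (h : RAC mbar C) (hC_closed : IsClosed C) (hC_convex : Convex ℝ C) :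
    ∃ σ : Strategy (stdSimplex ℝ A × stdSimplex ℝ B) (stdSimplex ℝ A), σ.IsDeterministic ∧
      ∀ τ : Strategy (stdSimplex ℝ A × stdSimplex ℝ B) (stdSimplex ℝ B),
        ∀ᵐ ω ∂play σ τ, ∀ T : ℕ, 1 ≤ T →
          Metric.infEDist (empiricalMixed T ω) (liftedSet mbar C) ≤
            ENNReal.ofReal (2 / √(T : ℝ)) := by
  obtain ⟨P, hP⟩ := h.exists_isMetricProj hC_closed hC_convex
  obtain ⟨σ, hdet, hσ⟩ := exists_isDeterministic_norm_le hP (fun _ hq => hq.1)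
    h.exists_prodDist_mem
  refine ⟨σ, hdet, fun τ => ?_⟩
  filter_upwards [hσ τ] with ω hω T hT
  exact (hP.infEDist_le _).trans (ENNReal.ofReal_le_ofReal (hω T hT))

variable [DecidableEq A] [DecidableEq B]

theorem RAC.approachableMixed (h : RAC mbar C) (hC_closed : IsClosed C)
    (hC_convex : Convex ℝ C) : ApproachableMixed diracPayoff (liftedSet mbar C) := by
  obtain ⟨σ, -, hσ⟩ := h.exists_mixed_rate hC_closed hC_convex
  refine ⟨σ, fun ε hε => ?_⟩
  -- This makes `2 / √T ≤ ε` for `T ≥ T₀`.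
  obtain ⟨T₀, hT₀⟩ := exists_nat_gt (4 / ε ^ 2)
  have hT₀pos : (0 : ℝ) < T₀ := lt_trans (by positivity) hT₀
  refine ⟨T₀, fun τ => ?_⟩
  have h1 : ∀ᵐ ω ∂play σ τ, ∀ T : ℕ, T₀ ≤ T →
      Metric.infEDist (averagePayoff (mixedExt diracPayoff) T ω) (liftedSet mbar C) ≤
        ENNReal.ofReal ε := by
    filter_upwards [hσ τ] with ω hω T hT
    have hTr : (T₀ : ℝ) ≤ T := by exact_mod_cast hT
    have hTpos : (0 : ℝ) < T := hT₀pos.trans_le hTr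
    rw [mixedExt_diracPayoff]
    refine (hω T (by exact_mod_cast hTpos)).trans (ENNReal.ofReal_le_ofReal ?_)
    rw [div_le_iff₀ (Real.sqrt_pos.2 hTpos), ← div_le_iff₀' hε]
    refine Real.le_sqrt_of_sq_le ?_
    rw [div_pow]
    linarith
  refine ofReal_one_sub_le_measure (t := {ω | ¬ ∀ T : ℕ, T₀ ≤ T →
      Metric.infEDist (averagePayoff (mixedExt diracPayoff) T ω) (liftedSet mbar C) ≤
        ENNReal.ofReal ε}) hε.le (fun ω hω => not_not.1 hω) ?_
  rw [Measure.real, ae_iff.1 h1]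
  exact hε.le

theorem ApproachesPure.robustApproachesPure [MeasurableSpace A] [MeasurableSpace B]
    (hM : 0 < M)
    (hbound : ∀ a b, ∀ s ∈ mbar a b, ‖s‖ ≤ M) {σ : Strategy (A × B) A}
    (hσ : ApproachesPure diracPayoff (liftedSet mbar C) σ) : RobustApproachesPure mbar C σ :=
  DrivesToZero.mono_of_le_mul hσ
    (K := M * √((Fintype.card A : ℝ) * Fintype.card B)) (by positivity)
    fun _ _ => excess_setExt_le hM hbound _

theorem ApproachesMixed.robustApproachesMixed (hM : 0 < M)
    (hbound : ∀ a b, ∀ s ∈ mbar a b, ‖s‖ ≤ M)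
    {σ : Strategy (stdSimplex ℝ A × stdSimplex ℝ B) (stdSimplex ℝ A)}
    (hσ : ApproachesMixed diracPayoff (liftedSet mbar C) σ) : RobustApproachesMixed mbar C σ := by
  rw [ApproachesMixed, mixedExt_diracPayoff] at hσ
  exact DrivesToZero.mono_of_le_mul hσ
    (K := M * √((Fintype.card A : ℝ) * Fintype.card B)) (by positivity)
    fun _ _ => excess_setExt_le hM hbound _

variable [MeasurableSpace A] [MeasurableSpace B] [DiscreteMeasurableSpace A]
  [DiscreteMeasurableSpace B]

theorem RAC.exists_pure_rates (h : RAC mbar C) (hC_closed : IsClosed C) (hC_convex : Convex ℝ C) :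
    ∃ σ : Strategy (A × B) A, ∀ τ : Strategy (A × B) B, ∀ δ : ℝ, 0 < δ → δ < 1 →
      ∀ T : ℕ, 1 ≤ T →
        ENNReal.ofReal (1 - δ) ≤ play σ τ {ω | ∀ S : ℕ, T ≤ S →
          Metric.infEDist (empiricalPure S ω) (liftedSet mbar C) ≤
            ENNReal.ofReal (2 * √(2 / (δ * T)))} ∧
        ENNReal.ofReal (1 - δ) ≤ play σ τ {ω |
          Metric.infEDist (empiricalPure T ω) (liftedSet mbar C) ≤
            ENNReal.ofReal (2 / √(T : ℝ) * (1 + 2 * √(Real.log (2 / δ))))} := by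
  obtain ⟨P, hP⟩ := h.exists_isMetricProj hC_closed hC_convex
  have hD : ∀ q ∈ liftedSet mbar C, WithLp.ofLp q ∈ stdSimplex ℝ (A × B) := fun _ hq => hq.1
  obtain ⟨σ, hσ⟩ := exists_isBlackwell hP h.exists_prodDist_mem
  refine ⟨σ, fun τ δ hδ hδ1 T hT => ?_⟩
  obtain ⟨m, rfl⟩ : ∃ m, T = m + 1 := ⟨T - 1, by omega⟩
  have hm : (0 : ℝ) < m + 1 := by positivity
  push_cast
  constructor
  -- The level is the square of `2 √(2 / (δ T))` with `T = m + 1`; the maximal inequality bounds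
  -- this exceptional set by `δ / 2`.
  · refine ofReal_one_sub_le_measure hδ.le (t := {ω | ∃ n, m ≤ n ∧
      8 / (δ * (m + 1)) ≤ projDist P n ω ^ 2}) (fun ω hω S hS => ?_) ?_
    · obtain ⟨n, rfl⟩ : ∃ n, S = n + 1 := ⟨S - 1, by omega⟩
      refine (hP.infEDist_le _).trans (ENNReal.ofReal_le_ofReal ?_)
      have hlt : projDist P n ω ^ 2 < 8 / (δ * (m + 1)) :=
        not_le.1 fun hle => hω ⟨n, by omega, hle⟩
      change projDist P n ω ≤ _
      refine le_of_sq_le_sq (hlt.le.trans (le_of_eq ?_)) (by positivity)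
      rw [mul_pow, Real.sq_sqrt (by positivity)]
      ring
    · refine (measureReal_exists_projDist_ge_le hP hD hσ τ m (by positivity)).trans ?_
      have e : (4 : ℝ) / ((m + 1) * (8 / (δ * (m + 1)))) = δ / 2 := by
        field_simp
        norm_num
      rw [e]
      linarith
  -- Chosen so that `2 exp (-L) = δ`. The tail bound gives the error `2 √L / √T`, smaller than the
  -- stated one.
  · set L := Real.log (2 / δ) with hL
    have hL0 : 0 ≤ L := Real.log_nonneg (by rw [le_div_iff₀ hδ]; linarith)
    refine ofReal_one_sub_le_measure hδ.le (t := {ω | 2 * √(L * (m + 1)) ≤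
      (m + 1) * projDist P m ω}) (fun ω hω => ?_) ?_
    · refine (hP.infEDist_le _).trans (ENNReal.ofReal_le_ofReal ?_)
      have hlt : (m + 1) * projDist P m ω < 2 * √(L * (m + 1)) := not_le.1 hω
      change projDist P m ω ≤ _
      have hs : 0 < √((m : ℝ) + 1) := Real.sqrt_pos.2 hm
      have hss : √((m : ℝ) + 1) * √((m : ℝ) + 1) = m + 1 := Real.mul_self_sqrt hm.le
      rw [Real.sqrt_mul hL0] at hlt
      have h1 : √((m : ℝ) + 1) * projDist P m ω ≤ 2 * √L := by
        refine le_of_mul_le_mul_left ?_ hs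
        rw [← mul_assoc, hss]
        linarith
      rw [div_mul_eq_mul_div, le_div_iff₀ hs]
      have := Real.sqrt_nonneg L
      linarith
    · refine (measureReal_projDist_ge_le hP hD hσ τ m hL0).trans (le_of_eq ?_)
      rw [hL, Real.exp_neg, Real.exp_log (by positivity)]
      field_simp

theorem RAC.approachablePure (h : RAC mbar C) (hC_closed : IsClosed C)
    (hC_convex : Convex ℝ C) : ApproachablePure diracPayoff (liftedSet mbar C) := by
  obtain ⟨σ, hσ⟩ := h.exists_pure_rates hC_closed hC_convex
  refine ⟨σ, fun ε hε => ?_⟩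
  -- The rate requires `δ < 1`, while `ε` may be large.
  set δ := min ε (1 / 2) with hδ
  have hδ0 : 0 < δ := by positivity
  obtain ⟨T₀, hT₀⟩ := exists_nat_gt (8 / (δ * ε ^ 2))
  have hT₀pos : (0 : ℝ) < T₀ := lt_trans (by positivity) hT₀
  refine ⟨T₀, fun τ => ?_⟩
  refine (ENNReal.ofReal_le_ofReal (by linarith [min_le_left ε (1 / 2)])).trans
    ((hσ τ δ hδ0 ((min_le_right _ _).trans_lt (by norm_num)) T₀
      (by exact_mod_cast hT₀pos)).1.trans (measure_mono fun ω hω T hT => ?_))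
  refine (hω T hT).trans (ENNReal.ofReal_le_ofReal ?_)
  refine le_of_sq_le_sq ?_ hε.le
  rw [mul_pow, Real.sq_sqrt (by positivity)]
  rw [div_lt_iff₀ (by positivity)] at hT₀
  rw [← mul_div_assoc, div_le_iff₀ (by positivity)]
  linarith

end Rates

end

end RobustApproachability

theorem mainTheorem2 {A B : Type*} [Fintype A] [Fintype B] [Nonempty A] [Nonempty B]
    [DecidableEq A] [DecidableEq B]
    [MeasurableSpace A] [MeasurableSpace B]
    [DiscreteMeasurableSpace A] [DiscreteMeasurableSpace B]
    {d : ℕ} (mbar : A → B → Set (EuclideanSpace ℝ (Fin d))) (M : ℝ) (hM : 0 < M)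
    (hbound : ∀ a b, ∀ s ∈ mbar a b, ‖s‖ ≤ M)
    (C : Set (EuclideanSpace ℝ (Fin d))) (hC_closed : IsClosed C) (hC_convex : Convex ℝ C) :
    -- characterization of robust approachability
    (RobustApproachability.RobustApproachablePure mbar C ↔ RobustApproachability.RAC mbar C) ∧
    (RobustApproachability.RobustApproachableMixed mbar C ↔ RobustApproachability.RAC mbar C) ∧
    -- the lifted set is closed and convex, and its approachability is equivalent to (RAC)
    IsClosed (RobustApproachability.liftedSet mbar C) ∧
    Convex ℝ (RobustApproachability.liftedSet mbar C) ∧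
    (RobustApproachability.ApproachablePure RobustApproachability.diracPayoff
        (RobustApproachability.liftedSet mbar C) ↔ RobustApproachability.RAC mbar C) ∧
    (RobustApproachability.ApproachableMixed RobustApproachability.diracPayoff
        (RobustApproachability.liftedSet mbar C) ↔ RobustApproachability.RAC mbar C) ∧
    -- comparison of the distances, for every joint distribution
    (∀ μ : EuclideanSpace ℝ (A × B), WithLp.ofLp μ ∈ stdSimplex ℝ (A × B) →
      RobustApproachability.excess (RobustApproachability.setExt mbar μ) C ≤
        ENNReal.ofReal (M * √((Fintype.card A : ℝ) * Fintype.card B)) *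
          Metric.infEDist μ (RobustApproachability.liftedSet mbar C)) ∧
    -- every strategy that approaches the lifted set also robust approaches `C`
    (∀ σ : RobustApproachability.Strategy (A × B) A,
      RobustApproachability.ApproachesPure RobustApproachability.diracPayoff
        (RobustApproachability.liftedSet mbar C) σ →
      RobustApproachability.RobustApproachesPure mbar C σ) ∧
    (∀ σ : RobustApproachability.Strategy (stdSimplex ℝ A × stdSimplex ℝ B) (stdSimplex ℝ A),
      RobustApproachability.ApproachesMixed RobustApproachability.diracPayoff
        (RobustApproachability.liftedSet mbar C) σ →
      RobustApproachability.RobustApproachesMixed mbar C σ) ∧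
    -- rates
    (RobustApproachability.RAC mbar C →
      -- mixed actions: a deterministic strategy, almost surely, at all times
      (∃ σ : RobustApproachability.Strategy (stdSimplex ℝ A × stdSimplex ℝ B) (stdSimplex ℝ A),
        σ.IsDeterministic ∧
        ∀ τ : RobustApproachability.Strategy (stdSimplex ℝ A × stdSimplex ℝ B) (stdSimplex ℝ B),
          ∀ᵐ ω ∂(RobustApproachability.play σ τ), ∀ T : ℕ, 1 ≤ T →
            Metric.infEDist (RobustApproachability.empiricalMixed T ω)
                (RobustApproachability.liftedSet mbar C) ≤ ENNReal.ofReal (2 / √(T : ℝ)) ∧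
            RobustApproachability.excess (RobustApproachability.setExt mbar
                (RobustApproachability.empiricalMixed T ω)) C ≤
              ENNReal.ofReal (2 * M * √((Fintype.card A : ℝ) * Fintype.card B / T))) ∧
      -- pure actions: a bound that holds simultaneously at all times after `T`
      (∃ σ : RobustApproachability.Strategy (A × B) A,
        ∀ τ : RobustApproachability.Strategy (A × B) B,
          ∀ δ : ℝ, 0 < δ → δ < 1 → ∀ T : ℕ, 1 ≤ T →
            ENNReal.ofReal (1 - δ) ≤ RobustApproachability.play σ τ {ω | ∀ S : ℕ, T ≤ S →
              Metric.infEDist (RobustApproachability.empiricalPure S ω)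
                  (RobustApproachability.liftedSet mbar C) ≤
                ENNReal.ofReal (2 * √(2 / (δ * T))) ∧
              RobustApproachability.excess (RobustApproachability.setExt mbar
                  (RobustApproachability.empiricalPure S ω)) C ≤
                ENNReal.ofReal (M * √((Fintype.card A : ℝ) * Fintype.card B) *
                  (2 * √(2 / (δ * T))))}) ∧
      -- pure actions: a bound at each time `T`, with a logarithmic dependence on `1 / δ`
      (∃ σ : RobustApproachability.Strategy (A × B) A,
        ∀ τ : RobustApproachability.Strategy (A × B) B,
          ∀ δ : ℝ, 0 < δ → δ < 1 → ∀ T : ℕ, 1 ≤ T →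
            ENNReal.ofReal (1 - δ) ≤ RobustApproachability.play σ τ {ω |
              Metric.infEDist (RobustApproachability.empiricalPure T ω)
                  (RobustApproachability.liftedSet mbar C) ≤
                ENNReal.ofReal (2 / √(T : ℝ) * (1 + 2 * √(Real.log (2 / δ)))) ∧
              RobustApproachability.excess (RobustApproachability.setExt mbar
                  (RobustApproachability.empiricalPure T ω)) C ≤
                ENNReal.ofReal (M * √((Fintype.card A : ℝ) * Fintype.card B) *
                  (2 / √(T : ℝ) * (1 + 2 * √(Real.log (2 / δ)))))}) ) := by
  refine ⟨⟨fun ⟨σ, hσ⟩ => hσ.rac hbound hC_closed hC_convex, fun h => ?_⟩,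
    ⟨fun ⟨σ, hσ⟩ => hσ.rac hbound hC_closed hC_convex, fun h => ?_⟩,
    RobustApproachability.isClosed_liftedSet hC_closed,
    RobustApproachability.convex_liftedSet hC_convex,
    ⟨fun ⟨σ, hσ⟩ => (hσ.robustApproachesPure hM hbound).rac hbound hC_closed hC_convex,
      fun h => h.approachablePure hC_closed hC_convex⟩,
    ⟨fun ⟨σ, hσ⟩ => (hσ.robustApproachesMixed hM hbound).rac hbound hC_closed hC_convex,
      fun h => h.approachableMixed hC_closed hC_convex⟩,
    fun μ _ => RobustApproachability.excess_setExt_le hM hbound μ,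
    fun σ hσ => hσ.robustApproachesPure hM hbound,
    fun σ hσ => hσ.robustApproachesMixed hM hbound, fun h => ⟨?_, ?_, ?_⟩⟩
  · obtain ⟨σ, hσ⟩ := h.approachablePure hC_closed hC_convex
    exact ⟨σ, hσ.robustApproachesPure hM hbound⟩
  · obtain ⟨σ, hσ⟩ := h.approachableMixed hC_closed hC_convex
    exact ⟨σ, hσ.robustApproachesMixed hM hbound⟩
  · obtain ⟨σ, hdet, hσ⟩ := h.exists_mixed_rate hC_closed hC_convex
    refine ⟨σ, hdet, fun τ => ?_⟩
    filter_upwards [hσ τ] with ω hω T hT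
    refine ⟨hω T hT, (RobustApproachability.excess_setExt_le_ofReal hM hbound
      (hω T hT)).trans_eq ?_⟩
    rw [Real.sqrt_div (by positivity)]
    congr 1
    ring
  · obtain ⟨σ, hσ⟩ := h.exists_pure_rates hC_closed hC_convex
    exact ⟨σ, fun τ δ hδ hδ1 T hT => (hσ τ δ hδ hδ1 T hT).1.trans (measure_mono fun ω hω S hS =>
      ⟨hω S hS, RobustApproachability.excess_setExt_le_ofReal hM hbound (hω S hS)⟩)⟩
  · obtain ⟨σ, hσ⟩ := h.exists_pure_rates hC_closed hC_convex
    exact ⟨σ, fun τ δ hδ hδ1 T hT => (hσ τ δ hδ hδ1 T hT).2.trans (measure_mono fun ω hω =>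
      ⟨hω, RobustApproachability.excess_setExt_le_ofReal hM hbound hω⟩)⟩
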